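/- **Setting.** Let $(M,g)$ be a smooth 4-dimensional Lorentzian manifold of signature $(-,+,+,+)$ with Levi-Civita connection $\nabla$, and let $(s,\underline{s},\vartheta)$, $\vartheta=(\theta^1,\theta^2)$, be a double null coordinate system on an open subset of $M$. That is: $s,\underline{s}$ are optical functions, $g(\nabla s,\nabla s)=g(\nabla\underline{s},\nabla\underline{s})=0$, with $g(\nabla s,\nabla\underline{s})>0$; and with $$L'=2\nabla s,\quad \underline{L}'=2\nabla\underline{s},\quad 2\Omega^{-2}=g(L',\underline{L}')\ (\Omega>0),\quad L=\Omega^2L',\quad \underline{L}=\Omega^2\underline{L}',$$ the functions $\theta^a$ are constant along the integral curves of $L$, and, on $\{\underline{s}=0\}$, also along those of $\underline{L}$. Put $b=\underline{L}-\partial_s=b^a\partial_a$, which is tangential to the surfaces $\Sigma_{s,\underline{s}}$ of constant $s,\underline{s}$. Let $\slashed{g}_{ab}=g(\partial_a,\partial_b)$ be the induced metric of $\Sigma_{s,\underline{s}}$, $\slashed{\nabla}$ its Levi-Civita connection and $\slashed{\Gamma}_{ij}^k$ its Christoffel symbols. For $X,Y$ tangential to $\Sigma_{s,\underline{s}}$,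 the background structure coefficients are $$\underline{\chi}(X,Y)=g(\nabla_X\underline{L},Y),\quad \chi'(X,Y)=g(\nabla_XL',Y),\quad \eta(X)=\tfrac12 g(\nabla_X\underline{L},L'),\quad \underline{\omega}=\underline{L}\log\Omega.$$ **The surface.** Fix $\underline{s}_0\in\mathbb{R}$, let $U\subset\mathbb{R}^2$ be open and let $f:U\to\mathbb{R}$ be of class $C^2$. Suppose that $\vartheta\mapsto(s,\underline{s},\vartheta)=(f(\vartheta),\underline{s}_0,\vartheta)$ maps $U$ into the coordinate domain and parametrises a spacelike surface $\Sigma$ in the null hypersurface $\underline{C}_{\underline{s}_0}=\{\underline{s}=\underline{s}_0\}$. Write $f_i=\partial_{\theta^i}f$, $\dot\partial_i=\partial_i+f_i\partial_s$ for the coordinate tangent vectors of $\Sigma$, $B_i^j=\delta_i^j-f_ib^j$, and $$\varepsilon'=-\slashed{g}^{kl}(B^{-1})_k^i(B^{-1})_l^jf_if_j,\qquad \varepsilon'^k=-2\slashed{g}^{kl}(B^{-1})_l^if_i,\qquad \vec{\varepsilon}'=\varepsilon'^k\partial_k,$$ $$\dot{\underline{L}}=\underline{L},\qquad \dot{L}'=L'+\varepsilon'\underline{L}+\varepsilon'^k\partial_k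 .$$ (The matrix $B$ is invertible because $\Sigma$ is spacelike.) **Proposition 4.3.** At every point of $\Sigma$, $\{\dot{\underline{L}},\dot{L}'\}$ is a conjugate null frame of $\Sigma$ (both vectors are null and normal to $\Sigma$, and $g(\dot{\underline{L}},\dot{L}')=2$), and $\dot{L}'$ is the only vector that forms such a frame with $\dot{\underline{L}}$. The corresponding structure coefficients $$\dot{\underline{\chi}}_{ij}=g(\nabla_{\dot\partial_i}\dot{\underline{L}},\dot\partial_j),\quad \dot{\chi}'_{ij}=g(\nabla_{\dot\partial_i}\dot{L}',\dot\partial_j),\quad \dot{\eta}_i=\tfrac12 g(\nabla_{\dot\partial_i}\dot{\underline{L}},\dot{L}')$$ are given by $$\dot{\underline{\chi}}_{ij}=\underline{\chi}_{ij}-2\,\mathrm{sym}\{\underline{\chi}(b)\otimes df\}_{ij}+\underline{\chi}(b,b)f_if_j,$$ $$\begin{aligned}\dot{\chi}'_{ij}={}&\chi'_{ij}+\varepsilon'\underline{\chi}_{ij}+(b\cdot\vec{\varepsilon}'-2)\slashed{\nabla}^2_{ij}f\\&+2\,\mathrm{sym}\big\{[\slashed{\nabla}b\cdot\vec{\varepsilon}'-\underline{\chi}(\vec{\varepsilon}')-\varepsilon'\underline{\chi}(b)-\chi'(b)-2\eta]\otimes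 df\big\}_{ij}\\&+\big[2\underline{\chi}(b,\vec{\varepsilon}')+\varepsilon'\underline{\chi}(b,b)+\chi'(b,b)+4b\cdot\eta-\slashed{\nabla}_bb\cdot\vec{\varepsilon}'+\partial_sb\cdot\vec{\varepsilon}'-4\underline{\omega}\big]f_if_j,\end{aligned}$$ $$\dot{\eta}_i=\eta_i+\tfrac12\underline{\chi}(\vec{\varepsilon}')_i+\big[2\underline{\omega}-b\cdot\eta-\tfrac12\underline{\chi}(b,\vec{\varepsilon}')\big]f_i.$$ Here the background quantities are evaluated at $(f(\vartheta),\underline{s}_0,\vartheta)$; $\mathrm{sym}(P\otimes Q)_{ij}=\frac12(P_iQ_j+P_jQ_i)$; $\underline{\chi}(v)_i=\underline{\chi}_{ij}v^j$ and likewise for $\chi'$; $\slashed{\nabla}^2_{ij}f=\partial_i\partial_jf-\slashed{\Gamma}_{ij}^kf_k$ with $\slashed{\Gamma}_{ij}^k$ taken along $\Sigma$; $\slashed{\nabla}_ib^k=\partial_ib^k+\slashed{\Gamma}_{ij}^kb^j$ is the covariant derivative on $\Sigma_{s,\underline{s}}$; $(\partial_sb)^k=\partial_s(b^k)$; $b\cdot\eta=b^i\eta_i$;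 $(\slashed{\nabla}b\cdot\vec{\varepsilon}')_i=\slashed{g}_{kl}\slashed{\nabla}_ib^k\varepsilon'^l$; and the other dots are inner products with respect to $\slashed{g}$. -/

import Mathlib

open scoped Manifold ContDiff Matrix

noncomputable section

namespace DoubleNull

/-- Coordinate space of a four-dimensional manifold. -/
abbrev R4 := EuclideanSpace ℝ (Fin 4)

/-- Coordinate space of a surface. -/
abbrev R2 := EuclideanSpace ℝ (Fin 2)

/-! ## Spacetimes -/

/-- The coordinate vector `∂_μ` at the point with coordinates `x`, for the chart `e`. -/
def coordVec {M : Type*} [TopologicalSpace M] [ChartedSpace R4 M]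
    (e : OpenPartialHomeomorph M R4) (x : R4) (μ : Fin 4) : TangentSpace (𝓡 4) (e.symm x) :=
  mfderiv (𝓡 4) (𝓡 4) e.symm x (EuclideanSpace.single μ (1 : ℝ) : R4)

/-- A smooth Lorentzian metric, of signature `(-,+,+,+)`: a symmetric bilinear form on every
tangent space which has a timelike vector with positive definite orthogonal complement, and whose
components in every smooth chart are smooth. -/
structure LorentzMetric (M : Type*) [TopologicalSpace M] [ChartedSpace R4 M] where
  val : ∀ p : M, TangentSpace (𝓡 4) p →ₗ[ℝ] TangentSpace (𝓡 4) p →ₗ[ℝ] ℝ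
  symm : ∀ (p : M) (X Y : TangentSpace (𝓡 4) p), val p X Y = val p Y X
  lorentz : ∀ p : M, ∃ T : TangentSpace (𝓡 4) p, val p T T < 0 ∧
    ∀ X : TangentSpace (𝓡 4) p, val p T X = 0 → X ≠ 0 → 0 < val p X X
  smooth : ∀ e ∈ IsManifold.maximalAtlas (𝓡 4) ∞ M, ∀ μ ν : Fin 4,
    ContDiffOn ℝ ∞ (fun x : R4 => val (e.symm x) (coordVec e x μ) (coordVec e x ν)) e.target

/-- The component matrix `g_{μν}` of the metric in the chart `e`, as a function of the
coordinates. -/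
def LorentzMetric.inChart {M : Type*} [TopologicalSpace M] [ChartedSpace R4 M]
    (g : LorentzMetric M) (e : OpenPartialHomeomorph M R4) (x : R4) :
    Matrix (Fin 4) (Fin 4) ℝ :=
  Matrix.of fun μ ν => g.val (e.symm x) (coordVec e x μ) (coordVec e x ν)

/-! ## Calculus in coordinates

Below `G` is the component matrix of a metric as a function of the coordinates, and tangent
vectors are given by their components. -/

/-- The partial derivative `∂_i F`. -/
def pd {n : ℕ} (i : Fin n) (F : EuclideanSpace ℝ (Fin n) → ℝ)
    (x : EuclideanSpace ℝ (Fin n)) : ℝ :=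
  fderiv ℝ F x (EuclideanSpace.single i (1 : ℝ))

/-- `g(X, Y)` at the point `x`. -/
def ip (G : R4 → Matrix (Fin 4) (Fin 4) ℝ) (x : R4) (X Y : Fin 4 → ℝ) : ℝ :=
  X ⬝ᵥ (G x *ᵥ Y)

/-- The gradient `∇h`, with components `g^{μν} ∂_ν h`. -/
def grad (G : R4 → Matrix (Fin 4) (Fin 4) ℝ) (h : R4 → ℝ) (x : R4) : Fin 4 → ℝ :=
  (G x)⁻¹ *ᵥ fun ν => pd ν h x

/-- The Christoffel symbols `Γ^l_{μν}` of the Levi-Civita connection of the metric. -/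
def christoffel (G : R4 → Matrix (Fin 4) (Fin 4) ℝ) (x : R4) (l μ ν : Fin 4) : ℝ :=
  (1 / 2) * ∑ σ, (G x)⁻¹ l σ *
    (pd μ (fun y => G y σ ν) x + pd ν (fun y => G y σ μ) x - pd σ (fun y => G y μ ν) x)

/-- The covariant derivative `∇_X Y` at the point `x` of a vector field `Y` along a tangent
vector `X`. -/
def covDeriv (G : R4 → Matrix (Fin 4) (Fin 4) ℝ) (x : R4) (X : Fin 4 → ℝ)
    (Y : R4 → Fin 4 → ℝ) : Fin 4 → ℝ :=
  fun l => ∑ μ, X μ * pd μ (fun y => Y y l) x +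
    ∑ μ, ∑ ν, christoffel G x l μ ν * X μ * Y x ν

/-! ## Double null coordinates

The coordinates of a point are `x = (s, us, θ¹, θ²)`, with indices `0, 1, 2, 3`. -/

/-- The spacetime index of the angular coordinate `θ^a`. -/
def ang (a : Fin 2) : Fin 4 := ![2, 3] a

/-- The coordinate vector `∂_s`. -/
def ds : Fin 4 → ℝ := Pi.single 0 1

/-- The angular coordinate vector `∂_a`. -/
def dAng (a : Fin 2) : Fin 4 → ℝ := Pi.single (ang a) 1

/-- `L' = 2 ∇s`. -/
def LP (G : R4 → Matrix (Fin 4) (Fin 4) ℝ) (x : R4) : Fin 4 → ℝ :=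
  (2 : ℝ) • grad G (fun y => y 0) x

/-- The underlined `L' = 2 ∇us`. -/
def uLP (G : R4 → Matrix (Fin 4) (Fin 4) ℝ) (x : R4) : Fin 4 → ℝ :=
  (2 : ℝ) • grad G (fun y => y 1) x

/-- The positive function `Ω` with `2 Ω⁻² = g(L', uL')`. -/
def Omega (G : R4 → Matrix (Fin 4) (Fin 4) ℝ) (x : R4) : ℝ :=
  Real.sqrt (2 / ip G x (LP G x) (uLP G x))

/-- `L = Ω² L'`. -/
def L (G : R4 → Matrix (Fin 4) (Fin 4) ℝ) (x : R4) : Fin 4 → ℝ := (Omega G x) ^ 2 • LP G x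

/-- The underlined `L = Ω² uL'`. -/
def uL (G : R4 → Matrix (Fin 4) (Fin 4) ℝ) (x : R4) : Fin 4 → ℝ := (Omega G x) ^ 2 • uLP G x

/-- Coordinates `(s, us, θ¹, θ²)` with values in the open set `D` are double null coordinates for
the metric with components `G`: `s` and `us` are optical functions, with `g(∇s, ∇us) > 0` (`s`
decreases and `us` increases in the future direction), the angular coordinates are constant along
the integral curves of `L`, and on `us = 0` also along those of `uL`. -/
structure IsDoubleNull (G : R4 → Matrix (Fin 4) (Fin 4) ℝ) (D : Set R4) : Prop where
  eikonal_s : ∀ x ∈ D, ip G x (grad G (fun y => y 0) x) (grad G (fun y => y 0) x) = 0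
  eikonal_us : ∀ x ∈ D, ip G x (grad G (fun y => y 1) x) (grad G (fun y => y 1) x) = 0
  pos : ∀ x ∈ D, 0 < ip G x (grad G (fun y => y 0) x) (grad G (fun y => y 1) x)
  L_ang : ∀ x ∈ D, ∀ a, L G x (ang a) = 0
  uL_ang : ∀ x ∈ D, x 1 = 0 → ∀ a, uL G x (ang a) = 0

/-- The angular components `b^a` of the vector field `b = uL - ∂_s`, which is tangential to the
surfaces of constant `s` and `us`. -/
def shift (G : R4 → Matrix (Fin 4) (Fin 4) ℝ) (x : R4) (a : Fin 2) : ℝ := (uL G x - ds) (ang a)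

/-- The induced metric on the surfaces of constant `s` and `us`. -/
def slashG (G : R4 → Matrix (Fin 4) (Fin 4) ℝ) (x : R4) : Matrix (Fin 2) (Fin 2) ℝ :=
  Matrix.of fun a c => ip G x (dAng a) (dAng c)

/-- The Christoffel symbols `Γ^k_{ij}` of the Levi-Civita connection of the induced metric on the
surfaces of constant `s` and `us`. -/
def slashGamma (G : R4 → Matrix (Fin 4) (Fin 4) ℝ) (x : R4) (k i j : Fin 2) : ℝ :=
  (1 / 2) * ∑ l, (slashG G x)⁻¹ k l *
    (pd (ang i) (fun y => slashG G y l j) x + pd (ang j) (fun y => slashG G y l i) x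
      - pd (ang l) (fun y => slashG G y i j) x)

/-- The covariant derivative of `b` on the surfaces of constant `s` and `us`; the entry `i k` is
`∂_i b^k + Γ^k_{ij} b^j`. -/
def slashNablaShift (G : R4 → Matrix (Fin 4) (Fin 4) ℝ) (x : R4) : Matrix (Fin 2) (Fin 2) ℝ :=
  Matrix.of fun i k => pd (ang i) (fun y => shift G y k) x +
    ∑ j, slashGamma G x k i j * shift G x j

/-- The components `∂_s b^k`. -/
def dsShift (G : R4 → Matrix (Fin 4) (Fin 4) ℝ) (x : R4) (k : Fin 2) : ℝ :=
  pd 0 (fun y => shift G y k) x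

/-! ### Structure coefficients of the double null foliation -/

/-- The null second fundamental form `g(∇_X uL, Y)`. -/
def uchi (G : R4 → Matrix (Fin 4) (Fin 4) ℝ) (x : R4) : Matrix (Fin 2) (Fin 2) ℝ :=
  Matrix.of fun i j => ip G x (covDeriv G x (dAng i) (uL G)) (dAng j)

/-- The null second fundamental form `χ'(X, Y) = g(∇_X L', Y)`. -/
def chiP (G : R4 → Matrix (Fin 4) (Fin 4) ℝ) (x : R4) : Matrix (Fin 2) (Fin 2) ℝ :=
  Matrix.of fun i j => ip G x (covDeriv G x (dAng i) (LP G)) (dAng j)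

/-- The torsion `η(X) = ½ g(∇_X uL, L')`. -/
def eta (G : R4 → Matrix (Fin 4) (Fin 4) ℝ) (x : R4) (i : Fin 2) : ℝ :=
  (1 / 2) * ip G x (covDeriv G x (dAng i) (uL G)) (LP G x)

/-- The underlined `ω`, that is `uL log Ω`. -/
def uomega (G : R4 → Matrix (Fin 4) (Fin 4) ℝ) (x : R4) : ℝ :=
  ∑ μ, uL G x μ * pd μ (fun y => Real.log (Omega G y)) x

/-! ## Surfaces in spacetime -/

/-- The parametrisation `ϑ ↦ (s, us, ϑ) = (f ϑ, us₀, ϑ)`. -/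
def graph (f : R2 → ℝ) (us₀ : ℝ) (ϑ : R2) : R4 := !₂[f ϑ, us₀, ϑ 0, ϑ 1]

/-- The coordinate tangent vectors `∂_i Φ` of a parametrised surface `Φ`. -/
def tang (Φ : R2 → R4) (ϑ : R2) (i : Fin 2) : Fin 4 → ℝ := fun μ => pd i (fun t => Φ t μ) ϑ

/-- The intrinsic metric of a parametrised surface. -/
def inducedMetric (G : R4 → Matrix (Fin 4) (Fin 4) ℝ) (Φ : R2 → R4) (ϑ : R2) :
    Matrix (Fin 2) (Fin 2) ℝ :=
  Matrix.of fun i j => ip G (Φ ϑ) (tang Φ ϑ i) (tang Φ ϑ j)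

/-- The covariant derivative in the direction `∂_i Φ` of a vector field `V` of the spacetime along
the parametrised surface `Φ`. -/
def covDerivAlong (G : R4 → Matrix (Fin 4) (Fin 4) ℝ) (Φ : R2 → R4) (V : R2 → Fin 4 → ℝ)
    (ϑ : R2) (i : Fin 2) : Fin 4 → ℝ :=
  fun l => pd i (fun t => V t l) ϑ +
    ∑ μ, ∑ ν, christoffel G (Φ ϑ) l μ ν * tang Φ ϑ i μ * V ϑ ν

/-- The second fundamental form `g(∇_i V, ∂_j Φ)` of the surface `Φ` with respect to a normal
vector field `V`. -/
def secondForm (G : R4 → Matrix (Fin 4) (Fin 4) ℝ) (Φ : R2 → R4) (V : R2 → Fin 4 → ℝ)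
    (ϑ : R2) (i j : Fin 2) : ℝ :=
  ip G (Φ ϑ) (covDerivAlong G Φ V ϑ i) (tang Φ ϑ j)

/-- The torsion `½ g(∇_i V, W)` of the surface `Φ` with respect to a frame `{V, W}` of normal
vector fields. -/
def torsion (G : R4 → Matrix (Fin 4) (Fin 4) ℝ) (Φ : R2 → R4) (V W : R2 → Fin 4 → ℝ)
    (ϑ : R2) (i : Fin 2) : ℝ :=
  (1 / 2) * ip G (Φ ϑ) (covDerivAlong G Φ V ϑ i) (W ϑ)

/-- `{V, W}` is a conjugate null frame of the surface `Φ` at the point of parameter `ϑ`: two null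
vectors normal to the surface, with `g(V, W) = 2`. -/
structure IsConjugateNullFrame (G : R4 → Matrix (Fin 4) (Fin 4) ℝ) (Φ : R2 → R4) (ϑ : R2)
    (V W : Fin 4 → ℝ) : Prop where
  null_left : ip G (Φ ϑ) V V = 0
  null_right : ip G (Φ ϑ) W W = 0
  normal_left : ∀ i, ip G (Φ ϑ) V (tang Φ ϑ i) = 0
  normal_right : ∀ i, ip G (Φ ϑ) W (tang Φ ϑ i) = 0
  conjugate : ip G (Φ ϑ) V W = 2

/-! ## Surfaces in a null hypersurface of constant `us` -/

/-- The matrix with entry `i j` equal to `B_i^j = δ_i^j - f_i b^j`. -/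
def Bmat (G : R4 → Matrix (Fin 4) (Fin 4) ℝ) (f : R2 → ℝ) (us₀ : ℝ) (ϑ : R2) :
    Matrix (Fin 2) (Fin 2) ℝ :=
  Matrix.of fun i j => (if i = j then 1 else 0) - pd i f ϑ * shift G (graph f us₀ ϑ) j

/-- `ε' = - g^{kl} (B⁻¹)_k^i (B⁻¹)_l^j f_i f_j`. -/
def eps (G : R4 → Matrix (Fin 4) (Fin 4) ℝ) (f : R2 → ℝ) (us₀ : ℝ) (ϑ : R2) : ℝ :=
  - ∑ k, ∑ l, ∑ i, ∑ j, (slashG G (graph f us₀ ϑ))⁻¹ k l *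
    (Bmat G f us₀ ϑ)⁻¹ k i * (Bmat G f us₀ ϑ)⁻¹ l j * pd i f ϑ * pd j f ϑ

/-- `ε'^k = - 2 g^{kl} (B⁻¹)_l^i f_i`. -/
def epsVec (G : R4 → Matrix (Fin 4) (Fin 4) ℝ) (f : R2 → ℝ) (us₀ : ℝ) (ϑ : R2) (k : Fin 2) : ℝ :=
  - 2 * ∑ l, ∑ i, (slashG G (graph f us₀ ϑ))⁻¹ k l * (Bmat G f us₀ ϑ)⁻¹ l i * pd i f ϑ

/-- The dotted underlined `L`, that is `uL` along the surface. -/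
def dotuL (G : R4 → Matrix (Fin 4) (Fin 4) ℝ) (f : R2 → ℝ) (us₀ : ℝ) (ϑ : R2) : Fin 4 → ℝ :=
  uL G (graph f us₀ ϑ)

/-- The dotted `L'`, that is `L' + ε' uL + ε'^k ∂_k` along the surface. -/
def dotLP (G : R4 → Matrix (Fin 4) (Fin 4) ℝ) (f : R2 → ℝ) (us₀ : ℝ) (ϑ : R2) : Fin 4 → ℝ :=
  LP G (graph f us₀ ϑ) + eps G f us₀ ϑ • uL G (graph f us₀ ϑ) +
    ∑ k, epsVec G f us₀ ϑ k • dAng k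

/-- The Hessian `∂_i ∂_j f - Γ^k_{ij} f_k`, where `Γ^k_{ij}` is pulled back from the surfaces of
constant `s` and `us`. -/
def slashHess (G : R4 → Matrix (Fin 4) (Fin 4) ℝ) (f : R2 → ℝ) (us₀ : ℝ) (ϑ : R2)
    (i j : Fin 2) : ℝ :=
  pd i (pd j f) ϑ - ∑ k, slashGamma G (graph f us₀ ϑ) k i j * pd k f ϑ

/-- `sym(P ⊗ Q)_{ij} = ½ (P_i Q_j + P_j Q_i)`. -/
def sym (P Q : Fin 2 → ℝ) (i j : Fin 2) : ℝ := (1 / 2) * (P i * Q j + P j * Q i)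

end DoubleNull

end

/-! In double null coordinates the metric is nearly explicit. Since g(∇x^ν, Y) = Y^ν, the eikonal
equations and the constancy of the angles along `L` give L' = Ω⁻² ∂_us and uL = ∂_s + b, with g(L',
·) = 2 ds and g(uL, ·) = 2 Ω² dus. Hence the us-row of the metric is known (`G_one`), and uL is null
and orthogonal to the whole hypersurface us = us₀.

The tangent vectors of the surface are ∂_i + f_i ∂_s = f_i uL + B_i^j ∂_j, so the induced metric is
B γ Bᵀ (`inducedMetric_graph`); positivity makes B and γ invertible. With w = γ ε⃗', the definition
of ε⃗' says B w = -2 df, that is w = (b·ε⃗' - 2) df (`slashG_mulVec_epsVec_apply`). This is the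
normality of the second frame vector, and 4 ε' = -|ε⃗'|² is its nullity.

For a normal field V, differentiating g(V, ∂_jΦ) = 0 gives g(∇_i V, ∂_jΦ) = -g(V, ∇_i ∂_jΦ)
(`secondForm_of_normal`). Thus ε' and ε⃗' need only be differentiable; their derivatives never
enter. What remains is ∂_i∂_j f g(V, ∂_s) plus Christoffel symbols contracted with V. Writing ∂_s =
uL - b turns each contraction into a background coefficient: χ', uχ, η, uω, the derivatives of b, or
the Christoffel symbols of γ. The relation for w then merges the last of these with ∂_i∂_j f into
the Hessian. For the torsion uL is differentiated directly, and the derivatives of b cancel. -/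

noncomputable section

namespace DoubleNull

/-! ## Partial derivatives -/

section PartialDerivatives

variable {n : ℕ} {F H : EuclideanSpace ℝ (Fin n) → ℝ} {x : EuclideanSpace ℝ (Fin n)}

lemma pd_congr (i : Fin n) (h : F =ᶠ[nhds x] H) : pd i F x = pd i H x := by
  unfold pd; rw [h.fderiv_eq]

lemma pd_const (i : Fin n) (c : ℝ) : pd i (fun _ => c) x = 0 := by
  simp [pd]

lemma pd_eq_zero_of_eventually_const (i : Fin n) {c : ℝ} (h : ∀ᶠ y in nhds x, F y = c) :
    pd i F x = 0 := by
  rw [pd_congr i (H := fun _ => c) h, pd_const]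

lemma pd_coord (i j : Fin n) : pd i (fun y => y j) x = if i = j then 1 else 0 := by
  have h : HasFDerivAt (fun y : EuclideanSpace ℝ (Fin n) => y j)
      (EuclideanSpace.proj j : EuclideanSpace ℝ (Fin n) →L[ℝ] ℝ) x :=
    (EuclideanSpace.proj j : EuclideanSpace ℝ (Fin n) →L[ℝ] ℝ).hasFDerivAt
  unfold pd
  rw [h.fderiv]
  simp [eq_comm]

lemma pd_mul (i : Fin n) (hF : DifferentiableAt ℝ F x) (hH : DifferentiableAt ℝ H x) :
    pd i (fun y => F y * H y) x = pd i F x * H x + F x * pd i H x := by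
  unfold pd
  rw [fderiv_fun_mul hF hH]
  simp; ring

lemma pd_const_mul (i : Fin n) (c : ℝ) (hF : DifferentiableAt ℝ F x) :
    pd i (fun y => c * F y) x = c * pd i F x := by
  rw [pd_mul i (by fun_prop) hF, pd_const]; ring

lemma pd_sum {ι : Type*} (s : Finset ι) (i : Fin n) {A : ι → EuclideanSpace ℝ (Fin n) → ℝ}
    (hA : ∀ k ∈ s, DifferentiableAt ℝ (A k) x) :
    pd i (fun y => ∑ k ∈ s, A k y) x = ∑ k ∈ s, pd i (A k) x := by
  unfold pd
  rw [fderiv_fun_sum hA]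
  simp

lemma pd_log (i : Fin n) (hF : DifferentiableAt ℝ F x) (h0 : F x ≠ 0) :
    pd i (fun y => Real.log (F y)) x = pd i F x / F x := by
  unfold pd
  rw [fderiv.log hF h0]
  simp; field_simp

/-- The chain rule for a map between coordinate spaces. -/
lemma pd_comp {m : ℕ} {Φ : EuclideanSpace ℝ (Fin m) → EuclideanSpace ℝ (Fin n)}
    {t : EuclideanSpace ℝ (Fin m)} (i : Fin m) (hF : DifferentiableAt ℝ F (Φ t))
    (hΦ : ∀ μ, DifferentiableAt ℝ (fun t => Φ t μ) t) :
    pd i (fun t => F (Φ t)) t = ∑ μ, pd i (fun t => Φ t μ) t * pd μ F (Φ t) := by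
  have hΦ' : DifferentiableAt ℝ Φ t := differentiableAt_euclidean.2 hΦ
  unfold pd
  have h1 : (fun t => F (Φ t)) = F ∘ Φ := rfl
  rw [h1, fderiv_comp t hF hΦ']
  set v := fderiv ℝ Φ t (EuclideanSpace.single i 1) with hv
  have h2 : ∀ μ, fderiv ℝ (fun t => Φ t μ) t (EuclideanSpace.single i 1) = v μ := by
    intro μ
    have := ((EuclideanSpace.proj μ : EuclideanSpace ℝ (Fin n) →L[ℝ] ℝ).hasFDerivAt.comp t
      hΦ'.hasFDerivAt).fderiv
    have h3 : (fun t => Φ t μ) = (EuclideanSpace.proj μ : EuclideanSpace ℝ (Fin n) →L[ℝ] ℝ) ∘ Φ :=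
      rfl
    rw [h3, this]; rfl
  simp only [h2, ContinuousLinearMap.comp_apply]
  rw [← hv]
  have h4 : v = ∑ μ, v μ • EuclideanSpace.single μ (1 : ℝ) := by
    ext k
    simp [Pi.single_apply]
  conv_lhs => rw [h4]
  simp

end PartialDerivatives

/-! ## Differentiability of inverse matrices -/

section MatrixInverse

variable {E ι : Type*} [NormedAddCommGroup E] [NormedSpace ℝ E] [Fintype ι] [DecidableEq ι]
  {A : E → Matrix ι ι ℝ} {x : E}

lemma differentiableAt_det (hA : ∀ i j, DifferentiableAt ℝ (fun y => A y i j) x) :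
    DifferentiableAt ℝ (fun y => (A y).det) x := by
  simp only [Matrix.det_apply]
  refine DifferentiableAt.fun_sum fun σ _ => DifferentiableAt.const_smul ?_ _
  exact (HasFDerivAt.finsetProd fun i _ => (hA _ _).hasFDerivAt).differentiableAt

lemma differentiableAt_inv_apply (hA : ∀ i j, DifferentiableAt ℝ (fun y => A y i j) x)
    (hdet : (A x).det ≠ 0) (i j : ι) : DifferentiableAt ℝ (fun y => (A y)⁻¹ i j) x := by
  -- Cramer's rule: each entry of the inverse is a quotient of determinants, the numerator having
  -- one row replaced by a constant unit vector.
  simp only [Matrix.inv_def, Ring.inverse_eq_inv', Matrix.smul_apply, smul_eq_mul,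
    Matrix.adjugate_apply]
  refine ((differentiableAt_det hA).inv hdet).mul (differentiableAt_det fun k l => ?_)
  by_cases hk : k = j
  · subst hk; simp
  · simpa [Matrix.updateRow_ne hk] using hA k l

end MatrixInverse

/-! ## The metric in double null coordinates -/

lemma sum_four {R : Type*} [AddCommMonoid R] (F : Fin 4 → R) :
    ∑ μ, F μ = F 0 + F 1 + ∑ a, F (ang a) := by
  simp [Fin.sum_univ_four, ang, add_assoc]

lemma forall_four {P : Fin 4 → Prop} (h0 : P 0) (h1 : P 1) (h : ∀ a, P (ang a)) : ∀ μ, P μ := by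
  intro μ
  fin_cases μ
  · exact h0
  · exact h1
  · exact h 0
  · exact h 1

@[simp] lemma ang_ne_zero (a : Fin 2) : ang a ≠ 0 := by fin_cases a <;> simp [ang]

@[simp] lemma ang_ne_one (a : Fin 2) : ang a ≠ 1 := by fin_cases a <;> simp [ang]

@[simp] lemma ang_inj (a c : Fin 2) : ang a = ang c ↔ a = c := by
  fin_cases a <;> fin_cases c <;> simp [ang]

/-- Smooth metric components on an open set of double null coordinates. -/
structure SmoothDoubleNull (G : R4 → Matrix (Fin 4) (Fin 4) ℝ) (D : Set R4) : Prop
    extends IsDoubleNull G D where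
  isOpen : IsOpen D
  comm : ∀ x μ ν, G x μ ν = G x ν μ
  smooth : ∀ μ ν, ContDiffOn ℝ ∞ (fun x => G x μ ν) D

variable {G : R4 → Matrix (Fin 4) (Fin 4) ℝ} {D : Set R4} {x : R4}

lemma ip_eq_sum (X Y : Fin 4 → ℝ) : ip G x X Y = ∑ μ, ∑ ν, X μ * G x μ ν * Y ν := by
  simp [ip, dotProduct, Matrix.mulVec, Finset.mul_sum, mul_assoc]

lemma grad_coord (μ ν : Fin 4) : grad G (fun y => y ν) x μ = (G x)⁻¹ μ ν := by
  simp [grad, pd_coord, Matrix.mulVec, dotProduct]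

lemma ip_add_right (X Y Z : Fin 4 → ℝ) : ip G x X (Y + Z) = ip G x X Y + ip G x X Z := by
  simp [ip, Matrix.mulVec_add]

lemma ip_add_left (X Y Z : Fin 4 → ℝ) : ip G x (X + Y) Z = ip G x X Z + ip G x Y Z := by
  simp [ip]

lemma ip_smul_right (c : ℝ) (X Y : Fin 4 → ℝ) : ip G x X (c • Y) = c * ip G x X Y := by
  simp [ip, Matrix.mulVec_smul]

lemma ip_smul_left (c : ℝ) (X Y : Fin 4 → ℝ) : ip G x (c • X) Y = c * ip G x X Y := by
  simp [ip]

lemma ip_sum_right {ι : Type*} (s : Finset ι) (X : Fin 4 → ℝ) (Y : ι → Fin 4 → ℝ) :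
    ip G x X (∑ k ∈ s, Y k) = ∑ k ∈ s, ip G x X (Y k) := by
  classical
  induction s using Finset.induction_on with
  | empty => simp [ip]
  | insert a s ha ih => rw [Finset.sum_insert ha, Finset.sum_insert ha, ip_add_right, ih]

lemma ip_single_right (X : Fin 4 → ℝ) (ν : Fin 4) :
    ip G x X (Pi.single ν 1) = ∑ μ, X μ * G x μ ν := by
  simp [ip_eq_sum, Pi.single_apply]

/-! ### Components of the null vectors and of the metric -/

namespace SmoothDoubleNull

variable (h : SmoothDoubleNull G D)
include h

lemma mem_nhds (hx : x ∈ D) : D ∈ nhds x := h.isOpen.mem_nhds hx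

lemma ip_comm (X Y : Fin 4 → ℝ) : ip G x X Y = ip G x Y X := by
  rw [ip_eq_sum, ip_eq_sum, Finset.sum_comm]
  refine Finset.sum_congr rfl fun μ _ => Finset.sum_congr rfl fun ν _ => ?_
  rw [h.comm x μ ν]; ring

lemma det_ne_zero (hx : x ∈ D) : (G x).det ≠ 0 := by
  intro h0
  have := h.pos x hx
  -- A singular matrix has inverse zero by convention, so all gradients would vanish, against
  -- `h.pos`.
  have hinv : (G x)⁻¹ = 0 := Matrix.nonsing_inv_apply_not_isUnit _ (by simp [h0])
  simp [ip, grad, hinv] at this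

lemma isUnit_det (hx : x ∈ D) : IsUnit (G x).det := (h.det_ne_zero hx).isUnit

lemma sum_inv_mul (hx : x ∈ D) (μ σ : Fin 4) :
    ∑ ν, (G x)⁻¹ ν μ * G x ν σ = if μ = σ then 1 else 0 := by
  have := congrFun (congrFun (Matrix.mul_nonsing_inv _ (h.isUnit_det hx)) σ) μ
  rw [Matrix.mul_apply, Matrix.one_apply] at this
  simp only [eq_comm (a := μ), ← this]
  exact Finset.sum_congr rfl fun ν _ => by rw [h.comm x ν σ]; ring

lemma inv_comm (μ ν : Fin 4) : (G x)⁻¹ μ ν = (G x)⁻¹ ν μ := by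
  have hs : (G x)ᵀ = G x := by ext i j; exact h.comm x j i
  have := congrFun (congrFun (Matrix.transpose_nonsing_inv (G x)) ν) μ
  rw [hs] at this
  exact this

/-- The gradient is the metric dual of the differential. All inner products with the background null
vectors reduce to reading off a component in this way. -/
lemma ip_grad_coord (hx : x ∈ D) (ν : Fin 4) (Y : Fin 4 → ℝ) :
    ip G x (grad G (fun y => y ν) x) Y = Y ν := by
  rw [ip_eq_sum, Finset.sum_comm]
  simp only [grad_coord, ← Finset.sum_mul, h.sum_inv_mul hx]
  simp

lemma ip_LP (hx : x ∈ D) (Y : Fin 4 → ℝ) : ip G x (LP G x) Y = 2 * Y 0 := by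
  rw [LP, ip_smul_left, h.ip_grad_coord hx]

lemma ip_uLP (hx : x ∈ D) (Y : Fin 4 → ℝ) : ip G x (uLP G x) Y = 2 * Y 1 := by
  rw [uLP, ip_smul_left, h.ip_grad_coord hx]

lemma inv_zero_zero (hx : x ∈ D) : (G x)⁻¹ 0 0 = 0 := by
  have := h.eikonal_s x hx
  rwa [h.ip_grad_coord hx, grad_coord] at this

lemma inv_one_one (hx : x ∈ D) : (G x)⁻¹ 1 1 = 0 := by
  have := h.eikonal_us x hx
  rwa [h.ip_grad_coord hx, grad_coord] at this

lemma inv_one_zero_pos (hx : x ∈ D) : 0 < (G x)⁻¹ 1 0 := by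
  have := h.pos x hx
  rw [h.ip_grad_coord hx, grad_coord] at this
  rwa [h.inv_comm]

lemma Omega_sq (hx : x ∈ D) : Omega G x ^ 2 = (2 * (G x)⁻¹ 1 0)⁻¹ := by
  have hp := h.inv_one_zero_pos hx
  have : ip G x (LP G x) (uLP G x) = 4 * (G x)⁻¹ 1 0 := by
    rw [h.ip_LP hx, uLP, Pi.smul_apply, grad_coord, h.inv_comm, smul_eq_mul]; ring
  rw [Omega, this, Real.sq_sqrt (by positivity)]
  field_simp; norm_num

lemma Omega_sq_pos (hx : x ∈ D) : 0 < Omega G x ^ 2 := by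
  have hp := h.inv_one_zero_pos hx
  rw [h.Omega_sq hx]; positivity

lemma Omega_ne_zero (hx : x ∈ D) : Omega G x ≠ 0 := fun h0 => by
  simpa [h0] using h.Omega_sq_pos hx

lemma LP_zero (hx : x ∈ D) : LP G x 0 = 0 := by
  simp [LP, grad_coord, h.inv_zero_zero hx]

lemma LP_one (hx : x ∈ D) : LP G x 1 = (Omega G x ^ 2)⁻¹ := by
  rw [h.Omega_sq hx]
  simp [LP, grad_coord]

lemma LP_ang (hx : x ∈ D) (a : Fin 2) : LP G x (ang a) = 0 := by
  have := h.L_ang x hx a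
  rw [L, Pi.smul_apply, smul_eq_mul] at this
  exact (mul_eq_zero.1 this).resolve_left (h.Omega_sq_pos hx).ne'

lemma uL_zero (hx : x ∈ D) : uL G x 0 = 1 := by
  have hp := h.inv_one_zero_pos hx
  rw [uL, h.Omega_sq hx]
  simp only [uLP, Pi.smul_apply, smul_eq_mul, grad_coord]
  rw [h.inv_comm 0 1]
  field_simp

lemma uL_one (hx : x ∈ D) : uL G x 1 = 0 := by
  simp [uL, uLP, grad_coord, h.inv_one_one hx]

omit h in
lemma _root_.DoubleNull.uL_ang_eq_shift (y : R4) (a : Fin 2) : uL G y (ang a) = shift G y a := by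
  simp [shift, ds]

lemma ip_uL (hx : x ∈ D) (Y : Fin 4 → ℝ) : ip G x (uL G x) Y = 2 * Omega G x ^ 2 * Y 1 := by
  rw [uL, ip_smul_left, h.ip_uLP hx]; ring

lemma sum_G_uL (hx : x ∈ D) (σ : Fin 4) :
    ∑ ν, G x σ ν * uL G x ν = if σ = 1 then 2 * Omega G x ^ 2 else 0 := by
  have := h.ip_uL hx (Pi.single σ 1)
  rw [ip_single_right] at this
  simp only [Pi.single_apply, eq_comm (a := (1 : Fin 4)), mul_ite, mul_one, mul_zero] at this
  rw [← this]
  exact Finset.sum_congr rfl fun ν _ => by rw [h.comm x ν σ]; ring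

/-- The only nonzero component of L' is the us-component Ω⁻², so g(L', ·) = 2 ds determines this row
of the metric. -/
lemma G_one (hx : x ∈ D) (σ : Fin 4) : G x 1 σ = if σ = 0 then 2 * Omega G x ^ 2 else 0 := by
  have h1 := h.ip_LP hx (Pi.single σ 1)
  have h2 := h.Omega_sq_pos hx
  rw [ip_single_right, sum_four] at h1
  simp only [h.LP_zero hx, h.LP_one hx, h.LP_ang hx, zero_mul, Finset.sum_const_zero,
    Pi.single_apply, eq_comm (a := (0 : Fin 4))] at h1
  rw [add_zero, zero_add, inv_mul_eq_iff_eq_mul₀ h2.ne'] at h1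
  rw [h1]
  split_ifs <;> ring

/-! ### Differentiability -/

lemma differentiableAt_G (hx : x ∈ D) (μ ν : Fin 4) : DifferentiableAt ℝ (fun y => G y μ ν) x :=
  ((h.smooth μ ν).contDiffAt (h.mem_nhds hx)).differentiableAt (by simp)

lemma differentiableAt_inv (hx : x ∈ D) (μ ν : Fin 4) :
    DifferentiableAt ℝ (fun y => (G y)⁻¹ μ ν) x :=
  differentiableAt_inv_apply (h.differentiableAt_G hx) (h.det_ne_zero hx) μ ν

/-- Replaces the definition through gradients by a single positive metric component, from which
differentiability of Ω is immediate. -/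
lemma Omega_eq_sqrt (hx : x ∈ D) : Omega G x = Real.sqrt (G x 1 0 / 2) := by
  rw [h.G_one hx, if_pos rfl, mul_div_cancel_left₀ _ two_ne_zero,
    Real.sqrt_sq (show 0 ≤ Omega G x from Real.sqrt_nonneg _)]

lemma differentiableAt_Omega (hx : x ∈ D) : DifferentiableAt ℝ (Omega G) x := by
  have h1 : DifferentiableAt ℝ (fun y => Real.sqrt (G y 1 0 / 2)) x := by
    have h2 := h.differentiableAt_G hx 1 0
    refine DifferentiableAt.sqrt (by fun_prop) ?_
    rw [h.G_one hx, if_pos rfl]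
    have := h.Omega_sq_pos hx
    positivity
  refine h1.congr_of_eventuallyEq ?_
  filter_upwards [h.mem_nhds hx] with y hy using h.Omega_eq_sqrt hy

lemma differentiableAt_LP (hx : x ∈ D) (μ : Fin 4) :
    DifferentiableAt ℝ (fun y => LP G y μ) x := by
  simp only [LP, Pi.smul_apply, grad_coord, smul_eq_mul]
  exact (h.differentiableAt_inv hx _ _).const_mul _

lemma differentiableAt_uL (hx : x ∈ D) (μ : Fin 4) :
    DifferentiableAt ℝ (fun y => uL G y μ) x := by
  simp only [uL, uLP, Pi.smul_apply, grad_coord, smul_eq_mul]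
  exact ((h.differentiableAt_Omega hx).pow 2).mul ((h.differentiableAt_inv hx _ _).const_mul _)

lemma differentiableAt_shift (hx : x ∈ D) (a : Fin 2) :
    DifferentiableAt ℝ (fun y => shift G y a) x := by
  simp only [← uL_ang_eq_shift]
  exact h.differentiableAt_uL hx _

/-! ### First derivatives -/

lemma pd_uL_zero (hx : x ∈ D) (μ : Fin 4) : pd μ (fun y => uL G y 0) x = 0 :=
  pd_eq_zero_of_eventually_const μ (c := 1) <| by
    filter_upwards [h.mem_nhds hx] with y hy using h.uL_zero hy

lemma pd_uL_one (hx : x ∈ D) (μ : Fin 4) : pd μ (fun y => uL G y 1) x = 0 :=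
  pd_eq_zero_of_eventually_const μ (c := 0) <| by
    filter_upwards [h.mem_nhds hx] with y hy using h.uL_one hy

lemma pd_LP_zero (hx : x ∈ D) (μ : Fin 4) : pd μ (fun y => LP G y 0) x = 0 :=
  pd_eq_zero_of_eventually_const μ (c := 0) <| by
    filter_upwards [h.mem_nhds hx] with y hy using h.LP_zero hy

lemma pd_LP_ang (hx : x ∈ D) (μ : Fin 4) (a : Fin 2) : pd μ (fun y => LP G y (ang a)) x = 0 :=
  pd_eq_zero_of_eventually_const μ (c := 0) <| by
    filter_upwards [h.mem_nhds hx] with y hy using h.LP_ang hy a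

lemma pd_G_one_of_ne (hx : x ∈ D) (μ : Fin 4) {σ : Fin 4} (hσ : σ ≠ 0) :
    pd μ (fun y => G y 1 σ) x = 0 :=
  pd_eq_zero_of_eventually_const μ (c := 0) <| by
    filter_upwards [h.mem_nhds hx] with y hy
    rw [h.G_one hy, if_neg hσ]

lemma pd_G_one_zero (hx : x ∈ D) (μ : Fin 4) :
    pd μ (fun y => G y 1 0) x = 4 * Omega G x * pd μ (Omega G) x := by
  have hΩ := h.differentiableAt_Omega hx
  rw [pd_congr (H := fun y => 2 * (Omega G y * Omega G y)) μ, pd_const_mul _ _ (hΩ.fun_mul hΩ),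
    pd_mul μ hΩ hΩ]
  · ring
  · filter_upwards [h.mem_nhds hx] with y hy
    rw [h.G_one hy, if_pos rfl]; ring

/-- The derivative of the identity `g(∂_σ, uL) = 0`, for `σ ≠ 1`. -/
lemma sum_pd_G_uL (hx : x ∈ D) (μ : Fin 4) {σ : Fin 4} (hσ : σ ≠ 1) :
    ∑ ν, pd μ (fun y => G y σ ν) x * uL G x ν
      = - ∑ a, G x σ (ang a) * pd μ (fun y => shift G y a) x := by
  have h1 : pd μ (fun y => ∑ ν, G y σ ν * uL G y ν) x = 0 :=
    pd_eq_zero_of_eventually_const μ (c := 0) <| by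
      filter_upwards [h.mem_nhds hx] with y hy
      rw [h.sum_G_uL hy, if_neg hσ]
  rw [pd_sum _ _ fun ν _ => (h.differentiableAt_G hx σ ν).fun_mul (h.differentiableAt_uL hx ν)] at h1
  simp only [pd_mul μ (h.differentiableAt_G hx σ _) (h.differentiableAt_uL hx _),
    Finset.sum_add_distrib] at h1
  rw [sum_four (fun ν => G x σ ν * _), h.pd_uL_zero hx, h.pd_uL_one hx] at h1
  simp only [uL_ang_eq_shift, mul_zero, zero_add] at h1
  linarith

end SmoothDoubleNull

/-! ## Christoffel symbols with a lowered index -/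

/-- The Christoffel symbols of the first kind, `Γ_{σμν} = g(∂_σ, ∇_μ ∂_ν)`. -/
def lowerGamma (G : R4 → Matrix (Fin 4) (Fin 4) ℝ) (x : R4) (σ μ ν : Fin 4) : ℝ :=
  (1 / 2) * (pd μ (fun y => G y σ ν) x + pd ν (fun y => G y σ μ) x - pd σ (fun y => G y μ ν) x)

/-- The component `g(N, ∇_μ ∂_ν)`. -/
def gammaForm (G : R4 → Matrix (Fin 4) (Fin 4) ℝ) (x : R4) (N : Fin 4 → ℝ) (μ ν : Fin 4) : ℝ :=
  ∑ σ, N σ * lowerGamma G x σ μ ν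

lemma gammaForm_add (N N' : Fin 4 → ℝ) (μ ν : Fin 4) :
    gammaForm G x (N + N') μ ν = gammaForm G x N μ ν + gammaForm G x N' μ ν := by
  simp [gammaForm, add_mul, Finset.sum_add_distrib]

lemma gammaForm_smul (c : ℝ) (N : Fin 4 → ℝ) (μ ν : Fin 4) :
    gammaForm G x (c • N) μ ν = c * gammaForm G x N μ ν := by
  simp [gammaForm, Finset.mul_sum, mul_assoc]

lemma gammaForm_sum_dAng (v : Fin 2 → ℝ) (μ ν : Fin 4) :
    gammaForm G x (∑ k, v k • dAng k) μ ν = ∑ k, v k * lowerGamma G x (ang k) μ ν := by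
  rw [gammaForm, sum_four]
  simp [dAng, Pi.single_apply]

lemma slashG_apply (i j : Fin 2) : slashG G x i j = G x (ang i) (ang j) := by
  simp [slashG, dAng, ip_single_right, Pi.single_apply]

namespace SmoothDoubleNull

variable (h : SmoothDoubleNull G D)
include h

lemma lowerGamma_comm (σ μ ν : Fin 4) : lowerGamma G x σ μ ν = lowerGamma G x σ ν μ := by
  simp only [lowerGamma, h.comm _ μ ν]; ring

lemma gammaForm_comm (N : Fin 4 → ℝ) (μ ν : Fin 4) :
    gammaForm G x N μ ν = gammaForm G x N ν μ := by
  simp only [gammaForm, h.lowerGamma_comm _ μ ν]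

/-- Compatibility of the connection with the metric. -/
lemma pd_G (μ σ ν : Fin 4) :
    pd μ (fun y => G y σ ν) x = lowerGamma G x σ μ ν + lowerGamma G x ν μ σ := by
  simp only [lowerGamma, h.comm _ ν σ, h.comm _ μ ν, h.comm _ μ σ]; ring

lemma sum_G_christoffel (hx : x ∈ D) (σ μ ν : Fin 4) :
    ∑ l, christoffel G x l μ ν * G x l σ = lowerGamma G x σ μ ν := by
  simp only [christoffel, mul_assoc, Finset.sum_mul, ← Finset.mul_sum]
  rw [Finset.sum_comm]
  have : ∀ τ, ∑ l, (G x)⁻¹ l τ * ((pd μ (fun y => G y τ ν) x + pd ν (fun y => G y τ μ) x -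
      pd τ (fun y => G y μ ν) x) * G x l σ) = (if τ = σ then 1 else 0) *
      (pd μ (fun y => G y τ ν) x + pd ν (fun y => G y τ μ) x - pd τ (fun y => G y μ ν) x) := by
    intro τ
    rw [← h.sum_inv_mul hx, Finset.sum_mul]
    exact Finset.sum_congr rfl fun l _ => by ring
  simp only [this, lowerGamma]
  simp

lemma ip_add_christoffel (hx : x ∈ D) (A X Y Z : Fin 4 → ℝ) :
    ip G x (fun l => A l + ∑ μ, ∑ ν, christoffel G x l μ ν * X μ * Y ν) Z =
      ip G x A Z + ∑ μ, ∑ ν, X μ * Y ν * gammaForm G x Z μ ν := by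
  have h1 : (fun l => A l + ∑ μ, ∑ ν, christoffel G x l μ ν * X μ * Y ν) =
      A + fun l => ∑ μ, ∑ ν, christoffel G x l μ ν * X μ * Y ν := rfl
  rw [h1, ip_add_left, ip_eq_sum (X := fun l => ∑ μ, ∑ ν, _)]
  congr 1
  simp only [gammaForm, ← h.sum_G_christoffel hx, Finset.mul_sum, Finset.sum_mul]
  rw [Finset.sum_comm]
  have e1 : ∀ (F : Fin 4 → Fin 4 → Fin 4 → Fin 4 → ℝ),
      ∑ a, ∑ b, ∑ c, ∑ d, F a b c d = ∑ c, ∑ d, ∑ a, ∑ b, F a b c d := by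
    intro F
    calc _ = ∑ a, ∑ c, ∑ b, ∑ d, F a b c d := Finset.sum_congr rfl fun a _ => Finset.sum_comm
      _ = ∑ c, ∑ a, ∑ b, ∑ d, F a b c d := Finset.sum_comm
      _ = ∑ c, ∑ a, ∑ d, ∑ b, F a b c d := Finset.sum_congr rfl fun c _ =>
          Finset.sum_congr rfl fun a _ => Finset.sum_comm
      _ = _ := Finset.sum_congr rfl fun c _ => Finset.sum_comm
  rw [e1]
  refine Finset.sum_congr rfl fun μ _ => Finset.sum_congr rfl fun ν _ =>
    Finset.sum_congr rfl fun a _ => Finset.sum_congr rfl fun b _ => by ring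

lemma ip_covDeriv_dAng (hx : x ∈ D) (i : Fin 2) (Y : R4 → Fin 4 → ℝ) (Z : Fin 4 → ℝ) :
    ip G x (covDeriv G x (dAng i) Y) Z = ip G x (fun l => pd (ang i) (fun y => Y y l) x) Z +
      ∑ ν, Y x ν * gammaForm G x Z (ang i) ν := by
  unfold covDeriv
  rw [h.ip_add_christoffel hx]
  simp [dAng, Pi.single_apply]

/-! ### Structure coefficients in terms of Christoffel symbols -/

/-- Comes from differentiating g(L', ∂_j) = 0. Only the us-component of L' varies and g(∂_us, ∂_j)
vanishes identically, so no derivative terms survive. -/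
lemma gammaForm_LP_ang_ang (hx : x ∈ D) (i j : Fin 2) :
    gammaForm G x (LP G x) (ang i) (ang j) = - chiP G x i j := by
  have h1 : ip G x (fun l => pd (ang i) (fun y => LP G y l) x) (dAng j) = 0 := by
    rw [dAng, ip_single_right, sum_four]
    simp [h.pd_LP_zero hx, h.pd_LP_ang hx, h.G_one hx]
  have h2 : ∑ ν, LP G x ν * pd (ang i) (fun y => G y (ang j) ν) x = 0 := by
    rw [sum_four]
    simp [h.LP_zero hx, h.LP_ang hx, h.comm _ (ang j) 1, h.pd_G_one_of_ne hx]
  simp only [h.pd_G, mul_add, Finset.sum_add_distrib] at h2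
  rw [chiP, Matrix.of_apply, h.ip_covDeriv_dAng hx, h1]
  have h3 : ∀ ν, gammaForm G x (dAng j) (ang i) ν = lowerGamma G x (ang j) (ang i) ν := by
    intro ν; simp [gammaForm, dAng, Pi.single_apply]
  simp only [h3]
  rw [gammaForm]
  linarith

lemma uchi_eq (hx : x ∈ D) (i j : Fin 2) :
    uchi G x i j = ∑ l, pd (ang i) (fun y => shift G y l) x * slashG G x l j +
      ∑ ν, uL G x ν * lowerGamma G x (ang j) (ang i) ν := by
  rw [uchi, Matrix.of_apply, h.ip_covDeriv_dAng hx]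
  have h3 : ∀ ν, gammaForm G x (dAng j) (ang i) ν = lowerGamma G x (ang j) (ang i) ν := by
    intro ν; simp [gammaForm, dAng, Pi.single_apply]
  simp only [h3]
  congr 1
  rw [dAng, ip_single_right, sum_four]
  simp [h.pd_uL_zero hx, h.pd_uL_one hx, uL_ang_eq_shift, slashG_apply]

lemma gammaForm_uL_ang_ang (hx : x ∈ D) (i j : Fin 2) :
    gammaForm G x (uL G x) (ang i) (ang j) = - uchi G x i j := by
  have h1 := h.sum_pd_G_uL hx (ang i) (ang_ne_one j)
  simp only [h.pd_G, add_mul, Finset.sum_add_distrib] at h1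
  rw [h.uchi_eq hx, gammaForm]
  simp only [mul_comm (uL G x _), slashG_apply, mul_comm (pd _ _ _), h.comm x _ (ang j)]
  linarith

lemma lowerGamma_ang_ang_uL (hx : x ∈ D) (i j : Fin 2) :
    lowerGamma G x (ang j) (ang i) 0 + ∑ a, shift G x a * lowerGamma G x (ang j) (ang i) (ang a) =
      uchi G x i j - ∑ l, pd (ang i) (fun y => shift G y l) x * slashG G x l j := by
  rw [h.uchi_eq hx, sum_four]
  simp [h.uL_zero hx, h.uL_one hx, uL_ang_eq_shift]

/-- Pairing with L' sees only the s-component, and that of uL is constantly 1; so η consists of its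
Christoffel part alone. -/
lemma gammaForm_LP_ang_uL (hx : x ∈ D) (i : Fin 2) :
    gammaForm G x (LP G x) (ang i) 0 + ∑ a, shift G x a * gammaForm G x (LP G x) (ang i) (ang a) =
      2 * eta G x i := by
  rw [eta, h.ip_covDeriv_dAng hx, h.ip_comm, h.ip_LP hx, sum_four]
  simp [h.uL_zero hx, h.uL_one hx, uL_ang_eq_shift, h.pd_uL_zero hx]

/-- The derivative of the identity `g(uL, uL) = 0`. -/
lemma sum_pd_G_uL_uL (hx : x ∈ D) (μ : Fin 4) :
    ∑ σ, uL G x σ * ∑ ν, pd μ (fun y => G y σ ν) x * uL G x ν = 0 := by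
  -- The excluded index σ = 1 does no harm because uL has no us-component; the other terms contract
  -- to g(uL, ∂_a) = 0.
  have h0 := fun σ (hσ : σ ≠ 1) => h.sum_pd_G_uL hx μ (σ := σ) hσ
  rw [sum_four, h.uL_one hx, zero_mul, h0 0 (by simp)]
  simp only [h0 _ (ang_ne_one _)]
  have h1 : ∀ a, ∑ σ, uL G x σ * G x σ (ang a) = 0 := by
    intro a
    have := h.sum_G_uL hx (ang a)
    simp only [h.comm x (ang a), ang_ne_one, if_false] at this
    simpa only [mul_comm] using this
  have h2 : ∑ a, (∑ σ, uL G x σ * G x σ (ang a)) * pd μ (fun y => shift G y a) x = 0 := by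
    simp [h1]
  simp only [sum_four (fun σ => uL G x σ * _), h.uL_one hx] at h2
  simp only [Fin.sum_univ_two] at h2 ⊢
  linarith

lemma gammaForm_uL_uL (hx : x ∈ D) (μ : Fin 4) :
    gammaForm G x (uL G x) μ 0 + ∑ a, shift G x a * gammaForm G x (uL G x) μ (ang a) = 0 := by
  have h1 := h.sum_pd_G_uL_uL hx μ
  simp only [h.pd_G, add_mul, Finset.sum_add_distrib, mul_add, Finset.mul_sum] at h1
  rw [Finset.sum_comm (f := fun σ ν => uL G x σ * (lowerGamma G x ν μ σ * uL G x ν))] at h1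
  have h2 : ∑ ν, uL G x ν * gammaForm G x (uL G x) μ ν = 0 := by
    simp only [gammaForm, Finset.mul_sum]
    rw [Finset.sum_comm]
    have h3 : ∀ F F' : Fin 4 → Fin 4 → ℝ, (∀ a b, F a b = F' a b) →
        ∑ a, ∑ b, F a b = ∑ a, ∑ b, F' a b := fun F F' hF => by simp only [hF]
    rw [h3 _ (fun σ ν => uL G x σ * (lowerGamma G x σ μ ν * uL G x ν)) (fun a b => by ring)]
    rw [h3 (fun σ ν => uL G x ν * (lowerGamma G x σ μ ν * uL G x σ))
      (fun σ ν => uL G x σ * (lowerGamma G x σ μ ν * uL G x ν)) (fun a b => by ring)] at h1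
    linarith
  rw [sum_four, h.uL_zero hx, h.uL_one hx] at h2
  simpa [uL_ang_eq_shift] using h2

/-- Of the three terms of the Christoffel symbol, the one differentiated along ∂_σ vanishes by
`sum_pd_G_uL_uL`, and the other two agree by symmetry. -/
lemma sum_lowerGamma_uL_uL (hx : x ∈ D) (σ : Fin 4) :
    ∑ μ, ∑ ν, uL G x μ * uL G x ν * lowerGamma G x σ μ ν =
      ∑ μ, uL G x μ * ∑ ν, pd μ (fun y => G y σ ν) x * uL G x ν := by
  have h1 := h.sum_pd_G_uL_uL hx σ
  have h2 : ∑ μ, ∑ ν, uL G x μ * uL G x ν * pd ν (fun y => G y σ μ) x =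
      ∑ μ, ∑ ν, uL G x μ * uL G x ν * pd μ (fun y => G y σ ν) x := by
    rw [Finset.sum_comm]
    exact Finset.sum_congr rfl fun _ _ => Finset.sum_congr rfl fun _ _ => by ring
  have h3 : ∀ F : Fin 4 → Fin 4 → ℝ, ∑ μ, uL G x μ * ∑ ν, F μ ν * uL G x ν =
      ∑ μ, ∑ ν, uL G x μ * uL G x ν * F μ ν := by
    intro F
    simp only [Finset.mul_sum]
    exact Finset.sum_congr rfl fun _ _ => Finset.sum_congr rfl fun _ _ => by ring
  rw [h3] at h1 ⊢
  have h4 : ∀ μ ν, uL G x μ * uL G x ν * lowerGamma G x σ μ ν =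
      (1 / 2) * (uL G x μ * uL G x ν * pd μ (fun y => G y σ ν) x) +
      (1 / 2) * (uL G x μ * uL G x ν * pd ν (fun y => G y σ μ) x) -
      (1 / 2) * (uL G x μ * uL G x ν * pd σ (fun y => G y μ ν) x) := by
    intro μ ν; rw [lowerGamma]; ring
  simp only [h4, Finset.sum_add_distrib, Finset.sum_sub_distrib, ← Finset.mul_sum]
  rw [h2, h1]; ring

omit h in
lemma _root_.DoubleNull.sum_mul_mul_eq (u : Fin 4 → ℝ) (F : Fin 4 → Fin 4 → ℝ) (h0 : u 0 = 1)
    (h1 : u 1 = 0) (hF : ∀ μ ν, F μ ν = F ν μ) :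
    ∑ μ, ∑ ν, u μ * u ν * F μ ν = F 0 0 + 2 * ∑ a, u (ang a) * F (ang a) 0 +
      ∑ a, ∑ c, u (ang a) * u (ang c) * F (ang a) (ang c) := by
  simp only [sum_four, h0, h1, Fin.sum_univ_two, hF 0 (ang _)]
  ring

lemma lowerGamma_ang_uL_uL (hx : x ∈ D) (k : Fin 2) :
    lowerGamma G x (ang k) 0 0 + 2 * ∑ a, shift G x a * lowerGamma G x (ang k) (ang a) 0 +
      ∑ a, ∑ c, shift G x a * shift G x c * lowerGamma G x (ang k) (ang a) (ang c) =
    - ∑ l, (dsShift G x l + ∑ a, shift G x a * pd (ang a) (fun y => shift G y l) x) *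
        slashG G x l k := by
  have h1 := h.sum_lowerGamma_uL_uL hx (ang k)
  rw [sum_mul_mul_eq _ _ (h.uL_zero hx) (h.uL_one hx) (h.lowerGamma_comm _)] at h1
  simp only [h.sum_pd_G_uL hx _ (ang_ne_one k), uL_ang_eq_shift] at h1
  rw [h1, sum_four]
  simp only [h.uL_zero hx, h.uL_one hx, uL_ang_eq_shift, Fin.sum_univ_two, dsShift, slashG_apply,
    h.comm x _ (ang k)]
  ring

lemma uomega_eq (hx : x ∈ D) :
    uomega G x = (∑ μ, uL G x μ * pd μ (Omega G) x) / Omega G x := by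
  simp only [uomega, pd_log _ (h.differentiableAt_Omega hx) (h.Omega_ne_zero hx), Finset.sum_div,
    mul_div_assoc]

/-- Contraction with L' selects the lowered index us, where the only varying metric component is 2
Ω². Its derivative along uL, divided by Ω², is 4 uL log Ω. -/
lemma gammaForm_LP_uL_uL (hx : x ∈ D) :
    gammaForm G x (LP G x) 0 0 + 2 * ∑ a, shift G x a * gammaForm G x (LP G x) (ang a) 0 +
      ∑ a, ∑ c, shift G x a * shift G x c * gammaForm G x (LP G x) (ang a) (ang c) =
    4 * uomega G x := by
  have hg : ∀ μ ν, gammaForm G x (LP G x) μ ν = (Omega G x ^ 2)⁻¹ * lowerGamma G x 1 μ ν := by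
    intro μ ν
    rw [gammaForm, sum_four]
    simp [h.LP_zero hx, h.LP_ang hx, h.LP_one hx]
  have h1 := h.sum_lowerGamma_uL_uL hx 1
  rw [sum_mul_mul_eq _ _ (h.uL_zero hx) (h.uL_one hx) (h.lowerGamma_comm _)] at h1
  have h2 : ∀ μ, ∑ ν, pd μ (fun y => G y 1 ν) x * uL G x ν =
      4 * Omega G x * pd μ (Omega G) x := by
    intro μ
    rw [sum_four]
    simp [h.pd_G_one_zero hx, h.pd_G_one_of_ne hx, h.uL_zero hx]
  have h3 : ∑ μ, uL G x μ * (4 * Omega G x * pd μ (Omega G) x) =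
      4 * Omega G x * ∑ μ, uL G x μ * pd μ (Omega G) x := by
    rw [Finset.mul_sum]; exact Finset.sum_congr rfl fun _ _ => by ring
  simp only [h2, h3, uL_ang_eq_shift] at h1
  have h4 : 4 * uomega G x = (Omega G x ^ 2)⁻¹ *
      (4 * Omega G x * ∑ μ, uL G x μ * pd μ (Omega G) x) := by
    have := h.Omega_ne_zero hx
    rw [h.uomega_eq hx]; field_simp
  rw [h4, ← h1]
  simp only [hg, Fin.sum_univ_two]
  ring

omit h in
lemma _root_.DoubleNull.sum_slashG_slashGamma (hdet : (slashG G x).det ≠ 0) (k i j : Fin 2) :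
    ∑ l, slashG G x k l * slashGamma G x l i j = lowerGamma G x (ang k) (ang i) (ang j) := by
  have h1 : ∀ τ, ∑ l, slashG G x k l * (slashG G x)⁻¹ l τ = if k = τ then 1 else 0 := by
    intro τ
    rw [← Matrix.mul_apply, Matrix.mul_nonsing_inv _ hdet.isUnit, Matrix.one_apply]
  have h2 : ∀ l, slashG G x k l * slashGamma G x l i j = ∑ τ,
      slashG G x k l * (slashG G x)⁻¹ l τ * lowerGamma G x (ang τ) (ang i) (ang j) := by
    intro l
    simp only [slashGamma, slashG_apply, lowerGamma, Finset.mul_sum]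
    exact Finset.sum_congr rfl fun _ _ => by ring
  simp only [h2]
  rw [Finset.sum_comm]
  simp only [← Finset.sum_mul, h1]
  simp

end SmoothDoubleNull

/-! ## Surfaces in spacetime -/

/-- Moves the derivative from the normal field to the tangent vector, by differentiating their
orthogonality along the surface. -/
lemma SmoothDoubleNull.secondForm_of_normal (h : SmoothDoubleNull G D) {Φ : R2 → R4} {ϑ : R2}
    (hx : Φ ϑ ∈ D) {V : R2 → Fin 4 → ℝ} {i j : Fin 2}
    (hΦ : ∀ μ, DifferentiableAt ℝ (fun t => Φ t μ) ϑ)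
    (hT : ∀ μ, DifferentiableAt ℝ (fun t => tang Φ t j μ) ϑ)
    (hV : ∀ μ, DifferentiableAt ℝ (fun t => V t μ) ϑ)
    (hn : ∀ᶠ t in nhds ϑ, ip G (Φ t) (V t) (tang Φ t j) = 0) :
    secondForm G Φ V ϑ i j = - (ip G (Φ ϑ) (V ϑ) (fun ν => pd i (fun t => tang Φ t j ν) ϑ) +
      ∑ μ, ∑ ν, tang Φ ϑ i μ * tang Φ ϑ j ν * gammaForm G (Φ ϑ) (V ϑ) μ ν) := by
  have h0 := pd_eq_zero_of_eventually_const i hn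
  simp only [ip_eq_sum] at h0
  have hΦ' : DifferentiableAt ℝ Φ ϑ := differentiableAt_euclidean.2 hΦ
  have hG : ∀ σ ν, DifferentiableAt ℝ (fun t => G (Φ t) σ ν) ϑ := fun σ ν =>
    (h.differentiableAt_G hx σ ν).comp ϑ hΦ'
  have hVG := fun σ ν => (hV σ).fun_mul (hG σ ν)
  have hVGT := fun σ ν => (hVG σ ν).fun_mul (hT ν)
  rw [pd_sum _ _ fun σ _ => DifferentiableAt.fun_sum fun ν _ => hVGT σ ν] at h0
  simp only [pd_sum _ _ fun ν _ => hVGT _ ν, pd_mul i (hVG _ _) (hT _), pd_mul i (hV _) (hG _ _),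
    pd_comp i (h.differentiableAt_G hx _ _) hΦ, add_mul, Finset.sum_add_distrib] at h0
  unfold secondForm covDerivAlong
  rw [h.ip_add_christoffel hx, ip_eq_sum, ip_eq_sum]
  -- Metric compatibility splits the derivative of the metric into the Christoffel parts of ∇_i ∂_jΦ
  -- and of ∇_i V.
  have h1 : ∑ σ, ∑ ν, V ϑ σ * (∑ μ, pd i (fun t => Φ t μ) ϑ * pd μ (fun y => G y σ ν) (Φ ϑ)) *
      tang Φ ϑ j ν = ∑ μ, ∑ ν, tang Φ ϑ i μ * tang Φ ϑ j ν * gammaForm G (Φ ϑ) (V ϑ) μ ν +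
      ∑ μ, ∑ ν, tang Φ ϑ i μ * V ϑ ν * gammaForm G (Φ ϑ) (tang Φ ϑ j) μ ν := by
    simp only [h.pd_G, gammaForm, Finset.mul_sum, Finset.sum_mul, mul_add, add_mul,
      Finset.sum_add_distrib]
    congr 1
    · rw [Finset.sum_comm_cycle]
      refine Finset.sum_congr rfl fun μ _ => ?_
      rw [Finset.sum_comm]
      exact Finset.sum_congr rfl fun ν _ => Finset.sum_congr rfl fun σ _ => by simp only [tang]; ring
    · rw [Finset.sum_comm_cycle]
      exact Finset.sum_congr rfl fun μ _ => Finset.sum_congr rfl fun ν _ =>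
        Finset.sum_congr rfl fun σ _ => by simp only [tang]; ring
  rw [h1] at h0
  linarith

/-! ## Graphs in a null hypersurface of constant `us` -/

section Graph

variable {U : Set R2} {f : R2 → ℝ} {us₀ : ℝ} {ϑ : R2}

@[simp] lemma graph_zero : graph f us₀ ϑ 0 = f ϑ := by simp [graph]

@[simp] lemma graph_one : graph f us₀ ϑ 1 = us₀ := by simp [graph]

@[simp] lemma graph_ang (a : Fin 2) : graph f us₀ ϑ (ang a) = ϑ a := by
  fin_cases a <;> simp [graph, ang]

lemma differentiableAt_graph (hf : DifferentiableAt ℝ f ϑ) (μ : Fin 4) :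
    DifferentiableAt ℝ (fun t => graph f us₀ t μ) ϑ := by
  revert μ
  refine forall_four ?_ ?_ fun a => ?_
  · simpa using hf
  · simp
  · simp only [graph_ang]
    exact (EuclideanSpace.proj a : R2 →L[ℝ] ℝ).differentiableAt

@[simp] lemma tang_graph_zero (i : Fin 2) : tang (graph f us₀) ϑ i 0 = pd i f ϑ := by
  simp [tang]

@[simp] lemma tang_graph_one (i : Fin 2) : tang (graph f us₀) ϑ i 1 = 0 := by
  simp [tang, pd_const]

@[simp] lemma tang_graph_ang (i a : Fin 2) :
    tang (graph f us₀) ϑ i (ang a) = if i = a then 1 else 0 := by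
  simp [tang, pd_coord]

lemma ip_tang_graph {x : R4} (i : Fin 2) (V : Fin 4 → ℝ) :
    ip G x V (tang (graph f us₀) ϑ i) = pd i f ϑ * ip G x V ds + ip G x V (dAng i) := by
  have : tang (graph f us₀) ϑ i = pd i f ϑ • ds + dAng i := by
    funext μ
    revert μ
    refine forall_four ?_ ?_ fun a => ?_ <;> simp [ds, dAng, Pi.single_apply, eq_comm]
  rw [this, ip_add_right, ip_smul_right]

lemma differentiableAt_pd (hU : IsOpen U) (hf : ContDiffOn ℝ 2 f U) (hϑ : ϑ ∈ U) (i : Fin 2) :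
    DifferentiableAt ℝ (pd i f) ϑ := by
  have h1 : ContDiffAt ℝ 2 f ϑ := hf.contDiffAt (hU.mem_nhds hϑ)
  have h2 : DifferentiableAt ℝ (fderiv ℝ f) ϑ :=
    (h1.fderiv_right (m := 1) (by norm_num)).differentiableAt (by simp)
  unfold pd
  fun_prop

namespace SmoothDoubleNull

variable (h : SmoothDoubleNull G D)
include h

/-- The second fundamental form of a graph with respect to a normal vector field. -/
lemma secondForm_graph (hU : IsOpen U) (hf : ContDiffOn ℝ 2 f U) (hϑ : ϑ ∈ U)
    (hx : graph f us₀ ϑ ∈ D) {V : R2 → Fin 4 → ℝ}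
    (hV : ∀ μ, DifferentiableAt ℝ (fun t => V t μ) ϑ)
    (hn : ∀ t ∈ U, ∀ j, ip G (graph f us₀ t) (V t) (tang (graph f us₀) t j) = 0) (i j : Fin 2) :
    secondForm G (graph f us₀) V ϑ i j =
      - (pd i (pd j f) ϑ * ip G (graph f us₀ ϑ) (V ϑ) ds +
        gammaForm G (graph f us₀ ϑ) (V ϑ) (ang i) (ang j) +
        pd j f ϑ * gammaForm G (graph f us₀ ϑ) (V ϑ) (ang i) 0 +
        pd i f ϑ * gammaForm G (graph f us₀ ϑ) (V ϑ) (ang j) 0 +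
        pd i f ϑ * pd j f ϑ * gammaForm G (graph f us₀ ϑ) (V ϑ) 0 0) := by
  have hf1 : DifferentiableAt ℝ f ϑ :=
    (hf.contDiffAt (hU.mem_nhds hϑ)).differentiableAt (by simp)
  have hT : ∀ μ, DifferentiableAt ℝ (fun t => tang (graph f us₀) t j μ) ϑ := by
    refine forall_four ?_ ?_ fun a => ?_
    · simpa using differentiableAt_pd hU hf hϑ j
    · simp
    · simp
  -- Only the s-component f_j of the tangent vector varies along the graph.
  have hdT : (fun ν => pd i (fun t => tang (graph f us₀) t j ν) ϑ) = pd i (pd j f) ϑ • ds := by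
    funext μ
    revert μ
    refine forall_four ?_ ?_ fun a => ?_ <;> simp [ds, pd_const]
  rw [h.secondForm_of_normal hx (differentiableAt_graph hf1) hT hV
    (by filter_upwards [hU.mem_nhds hϑ] with t ht using hn t ht j), hdT, ip_smul_right]
  simp [sum_four, Finset.sum_add_distrib, h.gammaForm_comm _ 0 (ang j)]
  ring

end SmoothDoubleNull

end Graph

/-! ### Inner products within the null hypersurface -/

namespace SmoothDoubleNull

variable (h : SmoothDoubleNull G D)
include h

lemma slashG_comm (i j : Fin 2) : slashG G x i j = slashG G x j i := by
  simp only [slashG_apply, h.comm x (ang i)]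

lemma G_ang_zero (hx : x ∈ D) (k : Fin 2) :
    G x (ang k) 0 = - (slashG G x *ᵥ shift G x) k := by
  have h1 := h.sum_G_uL hx (ang k)
  rw [sum_four, h.uL_zero hx, h.uL_one hx] at h1
  simp only [uL_ang_eq_shift, ang_ne_one, if_false, ← slashG_apply] at h1
  rw [Matrix.mulVec, dotProduct]
  linarith

lemma G_zero_zero (hx : x ∈ D) :
    G x 0 0 = shift G x ⬝ᵥ slashG G x *ᵥ shift G x := by
  have h1 := h.sum_G_uL hx 0
  rw [sum_four, h.uL_zero hx, h.uL_one hx] at h1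
  simp only [uL_ang_eq_shift, h.comm x 0 (ang _), h.G_ang_zero hx] at h1
  simp only [dotProduct, Fin.sum_univ_two] at h1 ⊢
  rw [if_neg (by simp)] at h1
  linarith

/-- A vector tangent to the hypersurface is V⁰ uL + (V^a - V⁰ b^a) ∂_a. The uL part is orthogonal to
everything tangent, and ∂_s = uL - b has angular part -b. -/
lemma ip_ds (hx : x ∈ D) (V : Fin 4 → ℝ) (hV : V 1 = 0) :
    ip G x V ds = - (shift G x ⬝ᵥ slashG G x *ᵥ fun a => V (ang a) - V 0 * shift G x a) := by
  rw [ds, ip_single_right, sum_four, hV, h.G_zero_zero hx]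
  simp only [h.G_ang_zero hx, dotProduct, Matrix.mulVec, Fin.sum_univ_two,
    h.slashG_comm (x := x) 1 0]
  ring

lemma ip_dAng (hx : x ∈ D) (V : Fin 4 → ℝ) (hV : V 1 = 0) (i : Fin 2) :
    ip G x V (dAng i) = (slashG G x *ᵥ fun a => V (ang a) - V 0 * shift G x a) i := by
  rw [dAng, ip_single_right, sum_four, hV]
  simp only [h.comm x 0, h.comm x _ (ang i), h.G_ang_zero hx, dotProduct, Matrix.mulVec,
    Fin.sum_univ_two, slashG_apply]
  ring

end SmoothDoubleNull

/-! ### The null frame of the graph and its structure coefficients -/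

section Graph

variable {U : Set R2} {f : R2 → ℝ} {us₀ : ℝ} {ϑ : R2}

lemma Bmat_mulVec (w : Fin 2 → ℝ) (i : Fin 2) :
    (Bmat G f us₀ ϑ *ᵥ w) i = w i - pd i f ϑ * (shift G (graph f us₀ ϑ) ⬝ᵥ w) := by
  simp [Matrix.mulVec, dotProduct, Bmat, sub_mul, Finset.mul_sum, Finset.sum_sub_distrib,
    -Fin.sum_univ_two, mul_assoc]

lemma epsVec_eq : epsVec G f us₀ ϑ = (-2 : ℝ) • ((slashG G (graph f us₀ ϑ))⁻¹ *ᵥ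
    ((Bmat G f us₀ ϑ)⁻¹ *ᵥ fun i => pd i f ϑ)) := by
  funext k
  simp only [epsVec, Pi.smul_apply, Matrix.mulVec, dotProduct, smul_eq_mul, Finset.mul_sum,
    mul_assoc]

lemma eps_eq : eps G f us₀ ϑ = - (((Bmat G f us₀ ϑ)⁻¹ *ᵥ fun i => pd i f ϑ) ⬝ᵥ
    (slashG G (graph f us₀ ϑ))⁻¹ *ᵥ ((Bmat G f us₀ ϑ)⁻¹ *ᵥ fun i => pd i f ϑ)) := by
  simp only [eps, Matrix.mulVec, dotProduct, Fin.sum_univ_two]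
  ring

/-- The angular part `ε'^k ∂_k` of the second null normal. -/
def epsField (G : R4 → Matrix (Fin 4) (Fin 4) ℝ) (f : R2 → ℝ) (us₀ : ℝ) (ϑ : R2) : Fin 4 → ℝ :=
  ∑ k, epsVec G f us₀ ϑ k • dAng k

@[simp] lemma epsField_zero : epsField G f us₀ ϑ 0 = 0 := by
  simp [epsField, dAng]

@[simp] lemma epsField_one : epsField G f us₀ ϑ 1 = 0 := by
  simp [epsField, dAng]

@[simp] lemma epsField_ang (a : Fin 2) : epsField G f us₀ ϑ (ang a) = epsVec G f us₀ ϑ a := by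
  fin_cases a <;> simp [epsField, dAng, Pi.single_apply]

lemma dotLP_eq : dotLP G f us₀ ϑ = LP G (graph f us₀ ϑ) +
    eps G f us₀ ϑ • uL G (graph f us₀ ϑ) + epsField G f us₀ ϑ := rfl

namespace SmoothDoubleNull

variable (h : SmoothDoubleNull G D)
include h

/-- Modulo the degenerate direction uL, the i-th tangent vector is B_i^j ∂_j. Invertibility of B and
γ is read off from this factorisation. -/
lemma inducedMetric_graph (hx : graph f us₀ ϑ ∈ D) :
    inducedMetric G (graph f us₀) ϑ =
      Bmat G f us₀ ϑ * slashG G (graph f us₀ ϑ) * (Bmat G f us₀ ϑ)ᵀ := by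
  ext i j
  have h1 : tang (graph f us₀) ϑ i 1 = 0 := tang_graph_one i
  rw [inducedMetric, Matrix.of_apply, ip_tang_graph, h.ip_ds hx _ h1, h.ip_dAng hx _ h1,
    Matrix.mul_assoc]
  simp only [tang_graph_zero, tang_graph_ang]
  set x := graph f us₀ ϑ
  have h2 := h.slashG_comm (x := x) 1 0
  simp only [Matrix.mul_apply, Matrix.transpose_apply, Bmat, Matrix.of_apply, Matrix.mulVec,
    dotProduct, Fin.sum_univ_two]
  fin_cases i <;> fin_cases j <;> simp [h2] <;> ring

variable (hx : graph f us₀ ϑ ∈ D) (hpos : (inducedMetric G (graph f us₀) ϑ).PosDef)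
include hx hpos

lemma det_Bmat_ne_zero : (Bmat G f us₀ ϑ).det ≠ 0 := by
  have h1 := hpos.det_pos
  rw [h.inducedMetric_graph hx, Matrix.det_mul, Matrix.det_mul] at h1
  intro h0
  simp [h0] at h1

lemma det_slashG_ne_zero : (slashG G (graph f us₀ ϑ)).det ≠ 0 := by
  have h1 := hpos.det_pos
  rw [h.inducedMetric_graph hx, Matrix.det_mul, Matrix.det_mul] at h1
  intro h0
  simp [h0] at h1

lemma slashG_mulVec_epsVec : slashG G (graph f us₀ ϑ) *ᵥ epsVec G f us₀ ϑ =
    (-2 : ℝ) • ((Bmat G f us₀ ϑ)⁻¹ *ᵥ fun i => pd i f ϑ) := by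
  rw [epsVec_eq, Matrix.mulVec_smul, Matrix.mulVec_mulVec,
    Matrix.mul_nonsing_inv _ (h.det_slashG_ne_zero hx hpos).isUnit, Matrix.one_mulVec]

/-- With w = γ ε⃗', the equation B w = -2 df reads w - (b·w) df = -2 df. It gives both normality of
the second frame vector and the Hessian term in χ'. -/
lemma slashG_mulVec_epsVec_apply (i : Fin 2) :
    (slashG G (graph f us₀ ϑ) *ᵥ epsVec G f us₀ ϑ) i =
      (shift G (graph f us₀ ϑ) ⬝ᵥ slashG G (graph f us₀ ϑ) *ᵥ epsVec G f us₀ ϑ - 2) *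
        pd i f ϑ := by
  have h1 := Bmat_mulVec (f := f) (us₀ := us₀) (ϑ := ϑ) (G := G)
    (slashG G (graph f us₀ ϑ) *ᵥ epsVec G f us₀ ϑ) i
  have h2 : Bmat G f us₀ ϑ *ᵥ (slashG G (graph f us₀ ϑ) *ᵥ epsVec G f us₀ ϑ) =
      (-2 : ℝ) • fun i => pd i f ϑ := by
    rw [h.slashG_mulVec_epsVec hx hpos, Matrix.mulVec_smul, Matrix.mulVec_mulVec,
      Matrix.mul_nonsing_inv _ (h.det_Bmat_ne_zero hx hpos).isUnit, Matrix.one_mulVec]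
  rw [h2, Pi.smul_apply, smul_eq_mul] at h1
  linarith

lemma four_mul_eps :
    4 * eps G f us₀ ϑ = - (epsVec G f us₀ ϑ ⬝ᵥ slashG G (graph f us₀ ϑ) *ᵥ epsVec G f us₀ ϑ) := by
  rw [h.slashG_mulVec_epsVec hx hpos, eps_eq, epsVec_eq, smul_dotProduct, dotProduct_smul,
    dotProduct_comm (_ *ᵥ (_ *ᵥ _))]
  simp only [smul_eq_mul]
  ring

omit hpos in
lemma ip_epsField_ds : ip G (graph f us₀ ϑ) (epsField G f us₀ ϑ) ds =
    - (shift G (graph f us₀ ϑ) ⬝ᵥ slashG G (graph f us₀ ϑ) *ᵥ epsVec G f us₀ ϑ) := by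
  rw [h.ip_ds hx _ epsField_one]
  simp

omit hpos in
lemma ip_epsField_dAng (i : Fin 2) : ip G (graph f us₀ ϑ) (epsField G f us₀ ϑ) (dAng i) =
    (slashG G (graph f us₀ ϑ) *ᵥ epsVec G f us₀ ϑ) i := by
  rw [h.ip_dAng hx _ epsField_one]
  simp

omit hpos in
lemma ip_epsField_self : ip G (graph f us₀ ϑ) (epsField G f us₀ ϑ) (epsField G f us₀ ϑ) =
    epsVec G f us₀ ϑ ⬝ᵥ slashG G (graph f us₀ ϑ) *ᵥ epsVec G f us₀ ϑ := by
  conv_lhs => arg 4; rw [epsField]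
  rw [ip_sum_right]
  simp only [ip_smul_right, h.ip_epsField_dAng hx, dotProduct]

omit hpos in
lemma ip_dotLP (Y : Fin 4 → ℝ) : ip G (graph f us₀ ϑ) (dotLP G f us₀ ϑ) Y =
    2 * Y 0 + eps G f us₀ ϑ * (2 * Omega G (graph f us₀ ϑ) ^ 2 * Y 1) +
      ip G (graph f us₀ ϑ) (epsField G f us₀ ϑ) Y := by
  rw [dotLP_eq, ip_add_left, ip_add_left, ip_smul_left, h.ip_LP hx, h.ip_uL hx]

omit hpos in
lemma ip_dotLP_ds : ip G (graph f us₀ ϑ) (dotLP G f us₀ ϑ) ds =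
    2 - shift G (graph f us₀ ϑ) ⬝ᵥ slashG G (graph f us₀ ϑ) *ᵥ epsVec G f us₀ ϑ := by
  rw [h.ip_dotLP hx, h.ip_epsField_ds hx]
  simp [ds]; ring

omit hpos in
lemma dotLP_one_mul : Omega G (graph f us₀ ϑ) ^ 2 * dotLP G f us₀ ϑ 1 = 1 := by
  have := h.Omega_ne_zero hx
  rw [dotLP_eq]
  simp [h.LP_one hx, h.uL_one hx, this]

lemma isConjugateNullFrame_dotLP :
    IsConjugateNullFrame G (graph f us₀) ϑ (dotuL G f us₀ ϑ) (dotLP G f us₀ ϑ) where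
  null_left := by rw [dotuL, h.ip_uL hx, h.uL_one hx, mul_zero]
  null_right := by
    have h1 : dotLP G f us₀ ϑ 0 = eps G f us₀ ϑ := by
      rw [dotLP_eq]
      simp [h.LP_zero hx, h.uL_zero hx]
    have h2 : ip G (graph f us₀ ϑ) (epsField G f us₀ ϑ) (dotLP G f us₀ ϑ) =
        epsVec G f us₀ ϑ ⬝ᵥ slashG G (graph f us₀ ϑ) *ᵥ epsVec G f us₀ ϑ := by
      rw [h.ip_comm, h.ip_dotLP hx, epsField_zero, epsField_one, h.ip_epsField_self hx]
      ring
    rw [h.ip_dotLP hx, h1, h2, mul_assoc 2, h.dotLP_one_mul hx]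
    linarith [h.four_mul_eps hx hpos]
  normal_left i := by rw [dotuL, h.ip_uL hx, tang_graph_one, mul_zero]
  normal_right i := by
    rw [ip_tang_graph, h.ip_dotLP_ds hx, h.ip_dotLP hx, h.ip_epsField_dAng hx,
      h.slashG_mulVec_epsVec_apply hx hpos]
    simp [dAng]
    ring
  conjugate := by rw [dotuL, h.ip_uL hx, mul_assoc, h.dotLP_one_mul hx, mul_one]

/-- The second null normal is determined by the first. -/
lemma isConjugateNullFrame_iff (N : Fin 4 → ℝ) :
    IsConjugateNullFrame G (graph f us₀) ϑ (dotuL G f us₀ ϑ) N ↔ N = dotLP G f us₀ ϑ := by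
  have hW := h.isConjugateNullFrame_dotLP hx hpos
  refine ⟨fun hN => ?_, fun hN => hN ▸ hW⟩
  -- The normalisation kills the us-component of the difference Δ, normality makes Δ a multiple of
  -- uL, and nullity then reads 4 Δ⁰ = 0.
  obtain ⟨Δ, rfl⟩ : ∃ Δ, N = dotLP G f us₀ ϑ + Δ := ⟨N - dotLP G f us₀ ϑ, by simp⟩
  have hΔ1 : Δ 1 = 0 := by
    have h1 := hN.conjugate
    rw [ip_add_right, hW.conjugate, dotuL, h.ip_uL hx] at h1
    have h2 := h.Omega_sq_pos hx
    have h3 : 2 * Omega G (graph f us₀ ϑ) ^ 2 * Δ 1 = 0 := by linarith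
    exact (mul_eq_zero.1 h3).resolve_left (by positivity)
  have hv : (fun a => Δ (ang a) - Δ 0 * shift G (graph f us₀ ϑ) a) = 0 := by
    refine Matrix.eq_zero_of_mulVec_eq_zero (h.det_slashG_ne_zero hx hpos)
      (Matrix.eq_zero_of_mulVec_eq_zero (h.det_Bmat_ne_zero hx hpos) ?_)
    funext i
    have h1 := hN.normal_right i
    rw [ip_add_left, hW.normal_right, ip_tang_graph, h.ip_ds hx _ hΔ1, h.ip_dAng hx _ hΔ1] at h1
    rw [Bmat_mulVec, Pi.zero_apply]
    linarith
  have hΔ : Δ = Δ 0 • dotuL G f us₀ ϑ := by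
    funext μ
    revert μ
    refine forall_four ?_ ?_ fun a => ?_
    · simp [dotuL, h.uL_zero hx]
    · simp [dotuL, h.uL_one hx, hΔ1]
    · have := congrFun hv a
      simp only [Pi.zero_apply] at this
      simp only [dotuL, Pi.smul_apply, uL_ang_eq_shift, smul_eq_mul]
      linarith
  have h0 := hN.null_right
  have hc := hW.conjugate
  rw [hΔ, ip_add_left, ip_add_right, ip_add_right, hW.null_right, ip_smul_left, ip_smul_right,
    ip_smul_left, ip_smul_right, hW.null_left, h.ip_comm (dotLP G f us₀ ϑ), hc] at h0
  have h00 : Δ 0 = 0 := by linarith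
  rw [hΔ, h00, zero_smul, add_zero]

omit hpos in
/-- The second fundamental form with respect to `uL`. -/
lemma secondForm_dotuL (hU : IsOpen U) (hf : ContDiffOn ℝ 2 f U) (hϑ : ϑ ∈ U)
    (hUD : ∀ t ∈ U, graph f us₀ t ∈ D) (i j : Fin 2) :
    secondForm G (graph f us₀) (dotuL G f us₀) ϑ i j =
      uchi G (graph f us₀ ϑ) i j
        - 2 * sym (uchi G (graph f us₀ ϑ) *ᵥ shift G (graph f us₀ ϑ)) (fun k => pd k f ϑ) i j
        + (shift G (graph f us₀ ϑ) ⬝ᵥ uchi G (graph f us₀ ϑ) *ᵥ shift G (graph f us₀ ϑ)) *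
          pd i f ϑ * pd j f ϑ := by
  have hf1 : DifferentiableAt ℝ f ϑ :=
    (hf.contDiffAt (hU.mem_nhds hϑ)).differentiableAt (by simp)
  have hΦ : DifferentiableAt ℝ (graph f us₀) ϑ :=
    differentiableAt_euclidean.2 (differentiableAt_graph hf1)
  rw [h.secondForm_graph hU hf hϑ hx (V := dotuL G f us₀)
    (fun μ => (h.differentiableAt_uL hx μ).comp ϑ hΦ)
    (fun t ht k => by rw [dotuL, h.ip_uL (hUD t ht), tang_graph_one, mul_zero])]
  simp only [dotuL]
  set x := graph f us₀ ϑ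
  have e0 : ip G x (uL G x) ds = 0 := by rw [h.ip_uL hx]; simp [ds]
  -- Index 0 is eliminated through ∂_s = uL - b; contractions of uL with ∇_μ uL vanish, so only uχ
  -- remains.
  have e1 := h.gammaForm_uL_ang_ang hx
  have e2 := fun μ => eq_neg_of_add_eq_zero_left (h.gammaForm_uL_uL hx μ)
  rw [e0, e2 0, e2 (ang i), e2 (ang j)]
  simp only [h.gammaForm_comm _ 0, e2 (ang _), e1, sym, Matrix.mulVec, dotProduct,
    Fin.sum_univ_two]
  ring

end SmoothDoubleNull

lemma gammaForm_dotLP (μ ν : Fin 4) :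
    gammaForm G (graph f us₀ ϑ) (dotLP G f us₀ ϑ) μ ν =
      gammaForm G (graph f us₀ ϑ) (LP G (graph f us₀ ϑ)) μ ν +
      eps G f us₀ ϑ * gammaForm G (graph f us₀ ϑ) (uL G (graph f us₀ ϑ)) μ ν +
      ∑ k, epsVec G f us₀ ϑ k * lowerGamma G (graph f us₀ ϑ) (ang k) μ ν := by
  rw [dotLP, gammaForm_add, gammaForm_add, gammaForm_smul, gammaForm_sum_dAng]

namespace SmoothDoubleNull

variable (h : SmoothDoubleNull G D)
include h

lemma differentiableAt_dotLP (hU : IsOpen U) (hf : ContDiffOn ℝ 2 f U) (hϑ : ϑ ∈ U)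
    (hx : graph f us₀ ϑ ∈ D) (hpos : (inducedMetric G (graph f us₀) ϑ).PosDef) (μ : Fin 4) :
    DifferentiableAt ℝ (fun t => dotLP G f us₀ t μ) ϑ := by
  have hf1 : DifferentiableAt ℝ f ϑ :=
    (hf.contDiffAt (hU.mem_nhds hϑ)).differentiableAt (by simp)
  have hΦ : DifferentiableAt ℝ (graph f us₀) ϑ :=
    differentiableAt_euclidean.2 (differentiableAt_graph hf1)
  have hdf := differentiableAt_pd hU hf hϑ
  have hb : ∀ a, DifferentiableAt ℝ (fun t => shift G (graph f us₀ t) a) ϑ := fun a =>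
    (h.differentiableAt_shift hx a).comp ϑ hΦ
  have hγ : ∀ a c, DifferentiableAt ℝ (fun t => slashG G (graph f us₀ t) a c) ϑ := by
    intro a c
    simp only [slashG_apply]
    exact (h.differentiableAt_G hx _ _).comp ϑ hΦ
  have hγi := differentiableAt_inv_apply (A := fun t => slashG G (graph f us₀ t)) hγ
    (h.det_slashG_ne_zero hx hpos)
  have hBi := differentiableAt_inv_apply (A := Bmat G f us₀) (x := ϑ)
    (fun i j => by
      simp only [Bmat, Matrix.of_apply]
      exact ((hdf i).fun_mul (hb j)).const_sub _) (h.det_Bmat_ne_zero hx hpos)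
  have hLP : DifferentiableAt ℝ (fun t => LP G (graph f us₀ t) μ) ϑ :=
    (h.differentiableAt_LP hx μ).comp ϑ hΦ
  have huL : DifferentiableAt ℝ (fun t => uL G (graph f us₀ t) μ) ϑ :=
    (h.differentiableAt_uL hx μ).comp ϑ hΦ
  have he : DifferentiableAt ℝ (fun t => eps G f us₀ t) ϑ := by
    unfold eps
    exact (DifferentiableAt.fun_sum fun k _ => DifferentiableAt.fun_sum fun l _ =>
      DifferentiableAt.fun_sum fun i _ => DifferentiableAt.fun_sum fun j _ =>
        ((((hγi k l).fun_mul (hBi k i)).fun_mul (hBi l j)).fun_mul (hdf i)).fun_mul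
          (hdf j)).fun_neg
  have hev : ∀ k, DifferentiableAt ℝ (fun t => epsVec G f us₀ t k) ϑ := by
    intro k
    unfold epsVec
    exact (DifferentiableAt.fun_sum fun l _ => DifferentiableAt.fun_sum fun i _ =>
      ((hγi k l).fun_mul (hBi l i)).fun_mul (hdf i)).const_mul _
  simp only [dotLP, Pi.add_apply, Pi.smul_apply, Finset.sum_apply, smul_eq_mul]
  exact (hLP.fun_add (he.fun_mul huL)).fun_add
    (DifferentiableAt.fun_sum fun k _ => (hev k).mul_const _)

/-- The second fundamental form with respect to the second null normal. -/
lemma secondForm_dotLP (hU : IsOpen U) (hf : ContDiffOn ℝ 2 f U) (hϑ : ϑ ∈ U)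
    (hUD : ∀ t ∈ U, graph f us₀ t ∈ D)
    (hpos : ∀ t ∈ U, (inducedMetric G (graph f us₀) t).PosDef) (i j : Fin 2) :
    let x := graph f us₀ ϑ
    let df : Fin 2 → ℝ := fun i => pd i f ϑ
    let b : Fin 2 → ℝ := shift G x
    let nb := slashNablaShift G x
    let γ := slashG G x
    let uχ := uchi G x
    let χ' := chiP G x
    let η := eta G x
    let ε := eps G f us₀ ϑ
    let εv := epsVec G f us₀ ϑ
    secondForm G (graph f us₀) (dotLP G f us₀) ϑ i j =
      χ' i j + ε * uχ i j + (b ⬝ᵥ γ *ᵥ εv - 2) * slashHess G f us₀ ϑ i j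
      + 2 * sym (nb *ᵥ (γ *ᵥ εv) - uχ *ᵥ εv - ε • (uχ *ᵥ b) - χ' *ᵥ b - (2 : ℝ) • η) df i j
      + (2 * (b ⬝ᵥ uχ *ᵥ εv) + ε * (b ⬝ᵥ uχ *ᵥ b) + b ⬝ᵥ χ' *ᵥ b + 4 * (b ⬝ᵥ η)
          - (b ᵥ* nb) ⬝ᵥ γ *ᵥ εv + dsShift G x ⬝ᵥ γ *ᵥ εv - 4 * uomega G x)
        * df i * df j := by
  intro x df b nb γ uχ χ' η ε εv
  have hx := hUD ϑ hϑ
  rw [h.secondForm_graph hU hf hϑ hx (h.differentiableAt_dotLP hU hf hϑ hx (hpos ϑ hϑ))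
    (fun t ht => (h.isConjugateNullFrame_dotLP (hUD t ht) (hpos t ht)).normal_right),
    h.ip_dotLP_ds hx]
  simp only [gammaForm_dotLP]
  have hrel := h.slashG_mulVec_epsVec_apply hx (hpos ϑ hϑ)
  have hΓ := sum_slashG_slashGamma (h.det_slashG_ne_zero hx (hpos ϑ hϑ))
  have hγ := h.slashG_comm (x := x) 1 0
  have u1 := h.gammaForm_uL_ang_ang hx
  have u2 := fun μ => eq_neg_of_add_eq_zero_left (h.gammaForm_uL_uL hx μ)
  have l1 := h.gammaForm_LP_ang_ang hx
  have l2 := fun k => eq_sub_of_add_eq (h.gammaForm_LP_ang_uL hx k)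
  have l3 := h.gammaForm_LP_uL_uL hx
  have c2 := fun a k => eq_sub_of_add_eq (h.lowerGamma_ang_ang_uL hx a k)
  have c3 := h.lowerGamma_ang_uL_uL hx
  rw [add_assoc] at l3
  have l3' := eq_sub_of_add_eq l3
  -- Each symbol with an index 0 is now solved for via ∂_s = uL - b. The resulting b^a Γ terms
  -- complete the partial derivatives of b to covariant ones.
  have c3' := fun k => eq_sub_of_add_eq ((add_assoc _ _ _).symm.trans (c3 k))
  rw [u2 0, l3']
  simp only [c3', h.gammaForm_comm _ 0, u2 (ang _), u1, l1, l2, c2, ← hΓ]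
  have r0 := hrel 0
  have r1 := hrel 1
  simp only [slashHess, sym, slashNablaShift, Matrix.of_apply, Pi.sub_apply, Pi.smul_apply,
    Matrix.mulVec, Matrix.vecMul, dotProduct, Fin.sum_univ_two, smul_eq_mul, x, df, b, nb, γ, uχ,
    χ', η, ε, εv] at hγ r0 r1 ⊢
  simp only [hγ] at r0 r1 ⊢
  -- What is left is (γ ε⃗')_l Γ^l_{ij} against (b·ε⃗' - 2) f_l Γ^l_{ij}, the correction term of the
  -- Hessian.
  linear_combination (- slashGamma G (graph f us₀ ϑ) 0 i j) * r0 -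
    slashGamma G (graph f us₀ ϑ) 1 i j * r1

/-- The torsion of the frame formed by the two null normals. -/
lemma torsion_dotuL_dotLP (hf1 : DifferentiableAt ℝ f ϑ) (hx : graph f us₀ ϑ ∈ D) (i : Fin 2) :
    let x := graph f us₀ ϑ
    let b : Fin 2 → ℝ := shift G x
    let uχ := uchi G x
    let εv := epsVec G f us₀ ϑ
    torsion G (graph f us₀) (dotuL G f us₀) (dotLP G f us₀) ϑ i =
      eta G x i + (1 / 2) * (uχ *ᵥ εv) i
      + (2 * uomega G x - b ⬝ᵥ eta G x - (1 / 2) * (b ⬝ᵥ uχ *ᵥ εv)) * pd i f ϑ := by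
  intro x b uχ εv
  have hd : ∀ μ, pd i (fun t => dotuL G f us₀ t μ) ϑ =
      pd i f ϑ * pd 0 (fun y => uL G y μ) x + pd (ang i) (fun y => uL G y μ) x := by
    intro μ
    have := pd_comp (Φ := graph f us₀) i (h.differentiableAt_uL hx μ) (differentiableAt_graph hf1)
    have ht : ∀ ν, pd i (fun t => graph f us₀ t ν) ϑ = tang (graph f us₀) ϑ i ν := fun _ => rfl
    simp only [ht] at this
    rw [sum_four] at this
    simpa [dotuL] using this
  -- The s- and us-components of uL are constant, so only the derivative of b along the surface
  -- contributes, paired with ε⃗'.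
  have hA : ip G x (fun l => pd i (fun t => dotuL G f us₀ t l) ϑ) (dotLP G f us₀ ϑ) =
      ∑ a, (pd i f ϑ * dsShift G x a + pd (ang i) (fun y => shift G y a) x) *
        (slashG G x *ᵥ εv) a := by
    rw [h.ip_comm, h.ip_dotLP hx, hd, hd, h.pd_uL_zero hx, h.pd_uL_zero hx, h.pd_uL_one hx,
      h.pd_uL_one hx, h.ip_comm]
    conv_lhs => arg 2; arg 4; rw [epsField]
    rw [ip_sum_right]
    have h1 : pd i (fun t => dotuL G f us₀ t 1) ϑ = 0 := by
      rw [hd, h.pd_uL_one hx, h.pd_uL_one hx, mul_zero, add_zero]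
    simp only [ip_smul_right, h.ip_dAng hx (fun l => pd i (fun t => dotuL G f us₀ t l) ϑ) h1]
    have h2 : ∀ μ, pd μ (fun y => uL G y 0) x = 0 := h.pd_uL_zero hx
    simp only [hd, h2, uL_ang_eq_shift, Fin.sum_univ_two, Matrix.mulVec, dotProduct,
      dsShift, x, εv, h.slashG_comm (x := graph f us₀ ϑ) 1 0]
    ring
  have hΓ : torsion G (graph f us₀) (dotuL G f us₀) (dotLP G f us₀) ϑ i = (1 / 2) *
      (ip G x (fun l => pd i (fun t => dotuL G f us₀ t l) ϑ) (dotLP G f us₀ ϑ) +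
      ∑ μ, ∑ ν, tang (graph f us₀) ϑ i μ * dotuL G f us₀ ϑ ν *
        gammaForm G x (dotLP G f us₀ ϑ) μ ν) := by
    unfold torsion covDerivAlong
    rw [h.ip_add_christoffel hx]
  have hS : ∑ μ, ∑ ν, tang (graph f us₀) ϑ i μ * dotuL G f us₀ ϑ ν *
        gammaForm G x (dotLP G f us₀ ϑ) μ ν =
      pd i f ϑ * (gammaForm G x (dotLP G f us₀ ϑ) 0 0 +
        ∑ a, b a * gammaForm G x (dotLP G f us₀ ϑ) (ang a) 0) +
      (gammaForm G x (dotLP G f us₀ ϑ) (ang i) 0 +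
        ∑ a, b a * gammaForm G x (dotLP G f us₀ ϑ) (ang i) (ang a)) := by
    have hu0 := h.uL_zero hx
    have hu1 := h.uL_one hx
    simp only [sum_four, dotuL, tang_graph_zero, tang_graph_one, tang_graph_ang, hu0, hu1,
      uL_ang_eq_shift, h.gammaForm_comm _ 0 (ang _), Fin.sum_univ_two, x, b]
    fin_cases i <;> simp <;> ring
  rw [hΓ, hA, hS]
  simp only [x, gammaForm_dotLP]
  have u1 := h.gammaForm_uL_ang_ang hx
  have u2 := fun μ => eq_neg_of_add_eq_zero_left (h.gammaForm_uL_uL hx μ)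
  have l2 := fun k => eq_sub_of_add_eq (h.gammaForm_LP_ang_uL hx k)
  have l3 := h.gammaForm_LP_uL_uL hx
  have c2 := fun a k => eq_sub_of_add_eq (h.lowerGamma_ang_ang_uL hx a k)
  have c3 := h.lowerGamma_ang_uL_uL hx
  rw [add_assoc] at l3
  have l3' := eq_sub_of_add_eq l3
  have c3' := fun k => eq_sub_of_add_eq ((add_assoc _ _ _).symm.trans (c3 k))
  rw [u2 0, l3']
  -- The derivatives of b produced by `c2` and `c3'` cancel those of `hA`, which is why none appears
  -- in the torsion.
  simp only [c3', h.gammaForm_comm _ 0, u2 (ang _), u1, l2, c2]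
  have hγ := h.slashG_comm (x := x) 1 0
  simp only [Matrix.mulVec, dotProduct, Fin.sum_univ_two, b, uχ, εv, x, dsShift] at hγ ⊢
  simp only [hγ]
  ring

end SmoothDoubleNull

end Graph

end DoubleNull

end

theorem proposition4p3 {M : Type*} [TopologicalSpace M] [ChartedSpace DoubleNull.R4 M]
    [IsManifold (𝓡 4) ∞ M] (g : DoubleNull.LorentzMetric M)
    (e : OpenPartialHomeomorph M DoubleNull.R4)
    (he : e ∈ IsManifold.maximalAtlas (𝓡 4) ∞ M)
    (hdn : DoubleNull.IsDoubleNull (g.inChart e) e.target)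
    (U : Set DoubleNull.R2) (hU : IsOpen U)
    (f : DoubleNull.R2 → ℝ) (hf : ContDiffOn ℝ 2 f U) (us₀ : ℝ)
    (hgraph : ∀ ϑ ∈ U, DoubleNull.graph f us₀ ϑ ∈ e.target)
    (hspacelike : ∀ ϑ ∈ U,
      (DoubleNull.inducedMetric (g.inChart e) (DoubleNull.graph f us₀) ϑ).PosDef) :
    ∀ ϑ ∈ U,
      let G := g.inChart e
      let Φ := DoubleNull.graph f us₀
      let x := Φ ϑ
      let df : Fin 2 → ℝ := fun i => DoubleNull.pd i f ϑ
      let b : Fin 2 → ℝ := DoubleNull.shift G x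
      let nb := DoubleNull.slashNablaShift G x
      let γ := DoubleNull.slashG G x
      let uχ := DoubleNull.uchi G x
      let χ' := DoubleNull.chiP G x
      let η := DoubleNull.eta G x
      let uω := DoubleNull.uomega G x
      let ε := DoubleNull.eps G f us₀ ϑ
      let εv := DoubleNull.epsVec G f us₀ ϑ
      (∀ N : Fin 4 → ℝ,
        DoubleNull.IsConjugateNullFrame G Φ ϑ (DoubleNull.dotuL G f us₀ ϑ) N ↔
          N = DoubleNull.dotLP G f us₀ ϑ) ∧
      (∀ i j, DoubleNull.secondForm G Φ (DoubleNull.dotuL G f us₀) ϑ i j =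
        uχ i j - 2 * DoubleNull.sym (uχ *ᵥ b) df i j + (b ⬝ᵥ uχ *ᵥ b) * df i * df j) ∧
      (∀ i j, DoubleNull.secondForm G Φ (DoubleNull.dotLP G f us₀) ϑ i j =
        χ' i j + ε * uχ i j + (b ⬝ᵥ γ *ᵥ εv - 2) * DoubleNull.slashHess G f us₀ ϑ i j
        + 2 * DoubleNull.sym
            (nb *ᵥ (γ *ᵥ εv) - uχ *ᵥ εv - ε • (uχ *ᵥ b) - χ' *ᵥ b - (2 : ℝ) • η) df i j
        + (2 * (b ⬝ᵥ uχ *ᵥ εv) + ε * (b ⬝ᵥ uχ *ᵥ b) + b ⬝ᵥ χ' *ᵥ b + 4 * (b ⬝ᵥ η)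
            - (b ᵥ* nb) ⬝ᵥ γ *ᵥ εv + DoubleNull.dsShift G x ⬝ᵥ γ *ᵥ εv - 4 * uω)
          * df i * df j) ∧
      (∀ i, DoubleNull.torsion G Φ (DoubleNull.dotuL G f us₀) (DoubleNull.dotLP G f us₀) ϑ i =
        η i + (1 / 2) * (uχ *ᵥ εv) i
        + (2 * uω - b ⬝ᵥ η - (1 / 2) * (b ⬝ᵥ uχ *ᵥ εv)) * df i) := by
  have h : DoubleNull.SmoothDoubleNull (g.inChart e) e.target :=
    { hdn with
      isOpen := e.open_target
      comm := fun x μ ν => g.symm _ _ _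
      smooth := fun μ ν => g.smooth e he μ ν }
  intro ϑ hϑ
  have hx := hgraph ϑ hϑ
  have hpos := hspacelike ϑ hϑ
  exact ⟨fun N => h.isConjugateNullFrame_iff hx hpos N,
    fun i j => h.secondForm_dotuL hx hU hf hϑ hgraph i j,
    fun i j => h.secondForm_dotLP hU hf hϑ hgraph hspacelike i j,
    fun i => h.torsion_dotuL_dotLP
      ((hf.contDiffAt (hU.mem_nhds hϑ)).differentiableAt (by simp)) hx i⟩
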